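/- For $n\ge 1$ let $B(\mathbb C^n)$ be the space of linear operators on $\mathbb C^n$, and put $\overline{S}^{++}(\mathbb C^n)=\{\rho\in B(\mathbb C^n):\rho>0,\ \operatorname{Tr}\rho\le 1\}$ and $\overline{S}(\mathbb C^n)=\{\rho\in B(\mathbb C^n):\rho\ge 0,\ \operatorname{Tr}\rho\le 1\}$. A linear map $T:B(\mathbb C^n)\to B(\mathbb C^m)$ is called CPTNI if it is completely positive and trace-non-increasing, i.e. $\operatorname{Tr}T(X)\le\operatorname{Tr}X$ for all $X\ge 0$. A family of functions $K^{(n)}:\overline{S}^{++}(\mathbb C^n)\times B(\mathbb C^n)\times B(\mathbb C^n)\to\mathbb C$, $(\rho,X,Y)\mapsto K^{(n)}_\rho(X,Y)$, $n\ge 1$, is called a family of CPTNI monotone metrics if (a) for every $n\ge 1$ and $\rho\in\overline{S}^{++}(\mathbb C^n)$, $K^{(n)}_\rho$ is a complex inner product on $B(\mathbb C^n)$ (conjugate-linear in the first variable); (b) for all $n,m\ge 1$, every CPTNI map $T:B(\mathbb C^n)\to B(\mathbb C^m)$, and all $X\in B(\mathbb C^n)$, $\rho\in\overline{S}^{++}(\mathbb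 C^n)$ and $\sigma\in\overline{S}(\mathbb C^m)$ with $T(\rho)+\sigma\in\overline{S}^{++}(\mathbb C^m)$, $$K^{(m)}_{T(\rho)+\sigma}(T(X),T(X))\le K^{(n)}_\rho(X,X).$$ No continuity in $\rho$ is required. A function $f:(0,\infty)\to(0,\infty)$ is called operator monotone if $0<A\le B$ implies $f(A)\le f(B)$ for Hermitian matrices $A,B$ of every size. For $\rho>0$ let $L_\rho(X)=\rho X$ and $R_\rho(X)=X\rho$ be the left and right multiplication operators on $B(\mathbb C^n)$; then $L_\rho R_\rho^{-1}$ is positive definite for the Hilbert–Schmidt inner product $\operatorname{Tr}X^*Y$, and $f(L_\rho R_\rho^{-1})$ is defined by functional calculus. **Theorem.** A family $\{K^{(n)}_{\cdot}(\cdot,\cdot)\}_{n\ge 1}$ of functions as above is a family of CPTNI monotone metrics if and only if there is an operator monotone function $f:(0,\infty)\to(0,\infty)$ such that $$K^{(n)}_\rho(X,Y)=\operatorname{Tr}X^*\bigl[(R_\rho f(L_\rho R_\rho^{-1}))^{-1}Y\bigr]$$ for all $n\ge 1$, $\rho\in\overline{S}^{++}(\mathbb C^n)$ and $X,Y\in B(\mathbb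 C^n)$. -/

import Mathlib

namespace CPTNI

open scoped ComplexOrder

/-- `B(ℂⁿ)`, the linear operators on `ℂⁿ`, written as `n × n` complex matrices. -/
abbrev Op (n : ℕ) : Type := Matrix (Fin n) (Fin n) ℂ

/-- Strictly positive operators on `ℂⁿ` of trace at most one. -/
def StrictSubState (n : ℕ) : Set (Op n) :=
  {ρ | ρ.PosDef ∧ ρ.trace.re ≤ 1}

/-- Positive semidefinite operators on `ℂⁿ` of trace at most one. -/
def SubState (n : ℕ) : Set (Op n) :=
  {ρ | ρ.PosSemidef ∧ ρ.trace.re ≤ 1}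

section CompletelyPositive

open scoped MatrixOrder Matrix.Norms.L2Operator CStarAlgebra

/-- A linear map `B(ℂⁿ) → B(ℂᵐ)` is completely positive, for the C⋆-algebra structures of
`B(ℂⁿ)` and `B(ℂᵐ)` (operator norm and Loewner order). -/
def IsCompletelyPositive {n m : ℕ} (T : Op n →ₗ[ℂ] Op m) : Prop :=
  ∃ φ : Op n →CP Op m, φ.toLinearMap = T

end CompletelyPositive

/-- Completely positive trace-non-increasing maps `B(ℂⁿ) → B(ℂᵐ)`. -/
structure IsCPTNI {n m : ℕ} (T : Op n →ₗ[ℂ] Op m) : Prop where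
  completelyPositive : IsCompletelyPositive T
  trace_le : ∀ X : Op n, X.PosSemidef → (T X).trace.re ≤ X.trace.re

/-- A family `K n ρ X Y` (read only for `n ≥ 1` and `ρ` strictly positive of trace at most one)
is a family of CPTNI monotone metrics. -/
structure IsMonotoneMetric (K : (n : ℕ) → Op n → Op n → Op n → ℂ) : Prop where
  /-- `K n ρ` is a complex inner product, conjugate-linear in the first variable. -/
  inner : ∀ n : ℕ, 0 < n → ∀ ρ ∈ StrictSubState n,
    ∃ c : InnerProductSpace.Core ℂ (Op n), ∀ X Y : Op n, c.inner X Y = K n ρ X Y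
  monotone : ∀ n m : ℕ, 0 < n → 0 < m → ∀ T : Op n →ₗ[ℂ] Op m, IsCPTNI T →
    ∀ X : Op n, ∀ ρ ∈ StrictSubState n, ∀ σ ∈ SubState m, T ρ + σ ∈ StrictSubState m →
      (K m (T ρ + σ) (T X) (T X)).re ≤ (K n ρ X X).re

/-- `f` (read only on `(0,∞)`) is operator monotone: `0 < A ≤ B` implies `f(A) ≤ f(B)` for
Hermitian matrices `A`, `B` of every size. -/
def OperatorMonotone (f : ℝ → ℝ) : Prop :=
  ∀ (n : ℕ) (A B : Op n), A.PosDef → B.PosDef → (B - A).PosSemidef →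
    (cfc f B - cfc f A).PosSemidef

/-- The super operator `L_ρ : X ↦ ρ X`. -/
noncomputable def superL {n : ℕ} (ρ : Op n) : Module.End ℂ (Op n) :=
  LinearMap.mulLeft ℂ ρ

/-- The super operator `R_ρ : X ↦ X ρ`. -/
noncomputable def superR {n : ℕ} (ρ : Op n) : Module.End ℂ (Op n) :=
  LinearMap.mulRight ℂ ρ

/-- Functional calculus `f(S)` of a super operator `S` on `B(ℂⁿ)` that is self-adjoint for the
Hilbert-Schmidt inner product, computed in the orthonormal basis of matrix units. -/
noncomputable def superCfc {n : ℕ} (f : ℝ → ℝ) (S : Module.End ℂ (Op n)) :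
    Module.End ℂ (Op n) :=
  Matrix.toLin (Matrix.stdBasis ℂ (Fin n) (Fin n)) (Matrix.stdBasis ℂ (Fin n) (Fin n))
    (cfc f (LinearMap.toMatrix (Matrix.stdBasis ℂ (Fin n) (Fin n))
      (Matrix.stdBasis ℂ (Fin n) (Fin n)) S))

/-- `Tr X* [(R_ρ f(L_ρ R_ρ⁻¹))⁻¹ Y]`. The inverses are inverses of super operators; they exist
for `ρ` positive definite and `f` positive on `(0,∞)`. -/
noncomputable def petzForm {n : ℕ} (f : ℝ → ℝ) (ρ X Y : Op n) : ℂ :=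
  (X.conjTranspose *
    (Ring.inverse (superR ρ * superCfc f (superL ρ * Ring.inverse (superR ρ))) Y)).trace

end CPTNI

/-! Write `J_ρ = R_ρ f(L_ρ R_ρ⁻¹)`. In an eigenbasis of `ρ` with eigenvalues `a i`, the matrix units
diagonalise `L_ρ` and `R_ρ` simultaneously, so the Petz form is `∑ |X i j|² / (a j f(a i / a j))`
(`petzForm_eq_sum`). Both directions are arguments about these weights.

Sufficiency. Let `T` have Kraus operators with `∑ Aₖᴴ Aₖ ≤ 1`, and let `ρ' = T ρ + σ`. The Schwarz
inequality for the Hilbert-Schmidt adjoint `T*` makes `V = R_ρ^{1/2} T* R_{ρ'}^{-1/2}` a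
contraction. The same inequality at `Yᴴ` gives `Vᴴ Δ_ρ V ≤ Δ_{ρ'}`, where `Δ_ρ = L_ρ R_ρ⁻¹`. The
operator Jensen inequality (`OperatorMonotone.posSemidef_sub_conj`) turns this into `Vᴴ f(Δ_ρ) V ≤
f(Δ_{ρ'})`, that is, `T J_ρ T* ≤ J_{ρ'}` (`sum_weight_krausAdj_le`). Dualising this inequality of
quadratic forms yields monotonicity of the inverse forms (`petzForm_krausMap_realDiag_le`).

Necessity. A CPTNI map with a CPTNI left inverse acts isometrically between matching base points.
Unitaries give unitary invariance. Coordinate embeddings, with `σ` filling the missing diagonal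
entries, show that the length of a matrix unit depends only on the eigenvalues it touches
(`IsMonotoneMetric.coordEmbed_conj`). Phases and projections make the matrix units orthogonal
(`IsMonotoneMetric.single_orthogonal`). Splitting `X` into `pX ⊕ rX` with `p + r = 1` makes `t²
K_{tρ}` additive in `t`; being nonnegative it is linear, so `K` is homogeneous of degree `-1` in `ρ`
without any continuity assumption (`IsMonotoneMetric.scale`). Off-diagonal lengths are thus governed
by one function `f` of the eigenvalue ratio. A Hadamard rotation at the state `1/2` of a qubit fixes
the diagonal lengths by `f 1` (`IsMonotoneMetric.re_single_half`).

Finally, taking `T` to be the identity shows that `K` decreases as `ρ` grows. At `ρ = ε diag(A, 1)`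
the last column of the form is the quadratic form of `f(A)⁻¹` up to scale, so `A ≤ B` forces `f(B)⁻¹
≤ f(A)⁻¹`, and inversion gives operator monotonicity. -/

namespace CPTNI

open scoped ComplexOrder Matrix
open Matrix Polynomial

/-! ### Functional calculus and order bounds for Hermitian matrices. -/

section FunctionalCalculus

/-- The diagonal matrix with the given real entries. -/
noncomputable abbrev realDiag {ι : Type*} [DecidableEq ι] (a : ι → ℝ) : Matrix ι ι ℂ :=
  diagonal fun i => (a i : ℂ)

lemma isHermitian_realDiag {ι : Type*} [DecidableEq ι] (a : ι → ℝ) : (realDiag a).IsHermitian := by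
  rw [isHermitian_diagonal_iff]; intro i; simp [IsSelfAdjoint]

variable {ι κ : Type*} [Fintype ι] [DecidableEq ι] [Fintype κ] [DecidableEq κ]

/-- Spectra of matrices are finite, so Lagrange interpolation reduces every identity of the
functional calculus to one about polynomials, with no regularity of `f`. -/
lemma exists_polynomial_eval_eq (f : ℝ → ℝ) {s : Set ℝ} (hs : s.Finite) :
    ∃ p : ℝ[X], ∀ x ∈ s, p.eval x = f x := by
  refine ⟨Lagrange.interpolate hs.toFinset id f, fun x hx => ?_⟩
  simpa using Lagrange.eval_interpolate_at_node f (s := hs.toFinset) (v := id)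
    Function.injective_id.injOn (hs.mem_toFinset.2 hx)

lemma cfc_eq_aeval {f : ℝ → ℝ} {A : Matrix ι ι ℂ} (hA : A.IsHermitian) {p : ℝ[X]}
    (h : ∀ x ∈ spectrum ℝ A, p.eval x = f x) : cfc f A = aeval A p := by
  rw [← cfc_polynomial p A hA.isSelfAdjoint]
  exact cfc_congr fun x hx => (h x hx).symm

/-- The functional calculus of Hermitian matrices commutes with algebra homomorphisms. -/
lemma map_cfc_of_isHermitian (f : ℝ → ℝ) {A : Matrix ι ι ℂ} (hA : A.IsHermitian)
    (φ : Matrix ι ι ℂ →ₐ[ℝ] Matrix κ κ ℂ) (hφ : (φ A).IsHermitian) :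
    cfc f (φ A) = φ (cfc f A) := by
  obtain ⟨p, hp⟩ := exists_polynomial_eval_eq f
    ((Matrix.finite_real_spectrum (A := A)).union (Matrix.finite_real_spectrum (A := φ A)))
  rw [cfc_eq_aeval hφ fun x hx => hp x (Or.inr hx), cfc_eq_aeval hA fun x hx => hp x (Or.inl hx),
    Polynomial.aeval_algHom_apply]

lemma aeval_realDiag (p : ℝ[X]) (a : ι → ℝ) :
    aeval (realDiag a) p = realDiag fun i => p.eval (a i) := by
  have h := Polynomial.aeval_algHom_apply
    ((Matrix.diagonalAlgHom ℝ : (ι → ℂ) →ₐ[ℝ] Matrix ι ι ℂ)) (fun i => (a i : ℂ)) p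
  simp only [diagonalAlgHom_apply] at h
  rw [h]
  congr 1
  funext i
  have h1 := Polynomial.aeval_algHom_apply (Pi.evalAlgHom ℝ (fun _ : ι => ℂ) i)
    (fun i => (a i : ℂ)) p
  simp only [Pi.evalAlgHom_apply] at h1
  rw [← h1]
  exact Polynomial.aeval_ofReal (K := ℂ) p (a i)

lemma cfc_realDiag (f : ℝ → ℝ) (a : ι → ℝ) :
    cfc f (realDiag a) = realDiag fun i => f (a i) := by
  obtain ⟨p, hp⟩ := exists_polynomial_eval_eq f
    ((Matrix.finite_real_spectrum (A := diagonal fun i => (a i : ℂ))).union (Set.finite_range a))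
  rw [cfc_eq_aeval (isHermitian_realDiag a) fun x hx => hp x (Or.inl hx), aeval_realDiag]
  simp only [hp _ (Or.inr (Set.mem_range_self _))]

/-- Conjugation by a unitary matrix. -/
noncomputable def conjHom (U : Matrix ι ι ℂ) (hU : Uᴴ * U = 1) : Matrix ι ι ℂ →ₐ[ℝ] Matrix ι ι ℂ :=
  AlgHom.ofLinearMap
    { toFun := fun A => U * A * Uᴴ
      map_add' := by intros; simp [mul_add, add_mul]
      map_smul' := by intros; simp }
    (by simpa using mul_eq_one_comm.1 hU)
    (by
      intro A B
      calc U * (A * B) * Uᴴ = U * A * (1 * B * Uᴴ) := by simp only [one_mul, mul_assoc]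
        _ = _ := by rw [← hU]; simp only [LinearMap.coe_mk, AddHom.coe_mk, mul_assoc])

lemma cfc_conj_realDiag (f : ℝ → ℝ) {U : Matrix ι ι ℂ} (hU : Uᴴ * U = 1) (a : ι → ℝ) :
    cfc f (U * realDiag a * Uᴴ) = U * (realDiag fun i => f (a i)) * Uᴴ := by
  have h := map_cfc_of_isHermitian f (isHermitian_realDiag a) (conjHom U hU)
    (isHermitian_mul_mul_conjTranspose _ (isHermitian_realDiag a))
  rwa [cfc_realDiag] at h

lemma IsHermitian.exists_eq_conj_realDiag {A : Matrix ι ι ℂ} (hA : A.IsHermitian) :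
    ∃ (U : Matrix ι ι ℂ) (a : ι → ℝ), Uᴴ * U = 1 ∧ A = U * realDiag a * Uᴴ := by
  refine ⟨hA.eigenvectorUnitary, hA.eigenvalues, ?_, ?_⟩
  · exact Unitary.coe_star_mul_self hA.eigenvectorUnitary
  · have := hA.spectral_theorem
    rwa [Unitary.conjStarAlgAut_apply] at this

lemma PosDef.exists_eq_conj_realDiag {A : Matrix ι ι ℂ} (hA : A.PosDef) :
    ∃ (U : Matrix ι ι ℂ) (a : ι → ℝ), Uᴴ * U = 1 ∧ (∀ i, 0 < a i) ∧
      A = U * realDiag a * Uᴴ := by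
  refine ⟨hA.1.eigenvectorUnitary, hA.1.eigenvalues, ?_, hA.eigenvalues_pos, ?_⟩
  · exact Unitary.coe_star_mul_self hA.1.eigenvectorUnitary
  · have := hA.1.spectral_theorem
    rwa [Unitary.conjStarAlgAut_apply] at this

lemma posSemidef_conj_iff {U : Matrix ι ι ℂ} (hU : Uᴴ * U = 1) {A : Matrix ι ι ℂ} :
    (U * A * Uᴴ).PosSemidef ↔ A.PosSemidef :=
  IsUnit.posSemidef_star_right_conjugate_iff
    (.of_mul_eq_one _ (mul_eq_one_comm.1 hU))

lemma PosSemidef.exists_eq_conjTranspose_mul_self {A : Matrix ι ι ℂ} (hA : A.PosSemidef) :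
    ∃ E : Matrix ι ι ℂ, A = Eᴴ * E := by
  obtain ⟨U, a, hU, rfl⟩ := IsHermitian.exists_eq_conj_realDiag hA.1
  have ha : ∀ i, 0 ≤ a i := fun i => by
    have h := (posSemidef_conj_iff hU).1 hA
    rw [posSemidef_diagonal_iff] at h
    exact_mod_cast h i
  refine ⟨realDiag (fun i => √(a i)) * Uᴴ, ?_⟩
  rw [conjTranspose_mul, conjTranspose_conjTranspose, (isHermitian_realDiag _).eq, mul_assoc,
    mul_assoc U, ← mul_assoc (realDiag _) (realDiag _), diagonal_mul_diagonal]
  congr 2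
  refine congrArg diagonal (funext fun i => ?_)
  rw [← Complex.ofReal_mul, Real.mul_self_sqrt (ha i)]

lemma conj_realDiag_inv {U : Matrix ι ι ℂ} (hU : Uᴴ * U = 1) {a : ι → ℝ}
    (ha : ∀ i, 0 < a i) :
    (U * realDiag a * Uᴴ)⁻¹ = U * realDiag (fun i => (a i)⁻¹) * Uᴴ := by
  refine Matrix.inv_eq_right_inv ?_
  calc U * realDiag a * Uᴴ * (U * realDiag (fun i => (a i)⁻¹) * Uᴴ)
      = U * (realDiag a * (Uᴴ * U) * realDiag (fun i => (a i)⁻¹)) * Uᴴ := by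
        simp only [mul_assoc]
    _ = 1 := by
        rw [hU, mul_one, diagonal_mul_diagonal]
        have : (fun i => ((a i : ℂ) * (((a i)⁻¹ : ℝ) : ℂ))) = fun _ => 1 := by
          funext i; rw [← Complex.ofReal_mul, mul_inv_cancel₀ (ha i).ne', Complex.ofReal_one]
        rw [this, diagonal_one, mul_one, mul_eq_one_comm.1 hU]

lemma posDef_conj_iff {U : Matrix ι ι ℂ} (hU : Uᴴ * U = 1) {A : Matrix ι ι ℂ} :
    (U * A * Uᴴ).PosDef ↔ A.PosDef :=
  IsUnit.posDef_star_right_conjugate_iff (.of_mul_eq_one _ (mul_eq_one_comm.1 hU))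

/-- A Hermitian matrix is bounded above by a multiple of the identity. -/
lemma IsHermitian.exists_posSemidef_smul_one_sub {A : Matrix ι ι ℂ} (hA : A.IsHermitian) :
    ∃ c : ℝ, 0 < c ∧ ((c : ℂ) • (1 : Matrix ι ι ℂ) - A).PosSemidef := by
  obtain ⟨U, a, hU, rfl⟩ := IsHermitian.exists_eq_conj_realDiag hA
  refine ⟨1 + ∑ i, |a i|, by positivity, ?_⟩
  have h1 : U * Uᴴ = 1 := mul_eq_one_comm.1 hU
  have : ((1 + ∑ i, |a i| : ℝ) : ℂ) • (1 : Matrix ι ι ℂ) - U * realDiag a * Uᴴ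
      = U * realDiag (fun i => 1 + ∑ i, |a i| - a i) * Uᴴ := by
    have : (realDiag (fun i => 1 + ∑ i, |a i| - a i) : Matrix ι ι ℂ)
      = ((1 + ∑ i, |a i| : ℝ) : ℂ) • 1 - realDiag a := by
      rw [smul_one_eq_diagonal, diagonal_sub]; simp
    rw [this, mul_sub, sub_mul]; simp [h1]
  rw [this, posSemidef_conj_iff hU, posSemidef_diagonal_iff]
  intro i
  rw [Complex.zero_le_real]
  have : a i ≤ ∑ i, |a i| :=
    (le_abs_self _).trans (Finset.single_le_sum (f := fun i => |a i|) (fun _ _ => abs_nonneg _)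
      (Finset.mem_univ i))
  linarith

/-- A positive definite matrix is bounded below by a positive multiple of the identity. -/
lemma PosDef.exists_posSemidef_sub_smul_one {A : Matrix ι ι ℂ} (hA : A.PosDef) :
    ∃ d : ℝ, 0 < d ∧ (A - (d : ℂ) • (1 : Matrix ι ι ℂ)).PosDef := by
  obtain ⟨U, a, hU, ha, rfl⟩ := PosDef.exists_eq_conj_realDiag hA
  have h1 : U * Uᴴ = 1 := mul_eq_one_comm.1 hU
  obtain ⟨d, hd, hda⟩ : ∃ d : ℝ, 0 < d ∧ ∀ i, d < a i := by
    rcases isEmpty_or_nonempty ι with h | h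
    · exact ⟨1, one_pos, fun i => h.elim i⟩
    · obtain ⟨i, hi⟩ := Finite.exists_min a
      exact ⟨a i / 2, half_pos (ha i), fun j => (half_lt_self (ha i)).trans_le (hi j)⟩
  refine ⟨d, hd, ?_⟩
  have : U * realDiag a * Uᴴ - (d : ℂ) • (1 : Matrix ι ι ℂ)
      = U * realDiag (fun i => a i - d) * Uᴴ := by
    have : (realDiag (fun i => a i - d) : Matrix ι ι ℂ)
      = realDiag a - (d : ℂ) • 1 := by
      rw [smul_one_eq_diagonal, diagonal_sub]; simp
    rw [this, mul_sub, sub_mul]; simp [h1]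
  rw [this, posDef_conj_iff hU, posDef_diagonal_iff]
  intro i
  exact_mod_cast sub_pos.2 (hda i)

end FunctionalCalculus

/-! ### The operator Jensen inequality. -/

section Jensen

variable {ι κ : Type*} [Fintype ι] [DecidableEq ι] [Fintype κ] [DecidableEq κ]

/-- Operator monotonicity for matrices with an arbitrary finite index type. -/
lemma OperatorMonotone.posSemidef_cfc_sub {f : ℝ → ℝ} (hf : OperatorMonotone f)
    {A B : Matrix ι ι ℂ} (hA : A.PosDef) (hB : B.PosDef) (hAB : (B - A).PosSemidef) :
    (cfc f B - cfc f A).PosSemidef := by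
  let e := Fintype.equivFin ι
  let φ : Matrix ι ι ℂ →ₐ[ℝ] Op (Fintype.card ι) :=
    ((Matrix.reindexAlgEquiv ℂ ℂ e).toAlgHom).restrictScalars ℝ
  have hφ : ∀ M, φ M = M.submatrix e.symm e.symm := fun M => rfl
  have h := hf _ (φ A) (φ B) (hA.submatrix e.symm.injective) (hB.submatrix e.symm.injective)
    (by rw [← map_sub, hφ]; exact hAB.submatrix _)
  rw [map_cfc_of_isHermitian f hA.1 φ (hA.1.submatrix _),
    map_cfc_of_isHermitian f hB.1 φ (hB.1.submatrix _), ← map_sub, hφ] at h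
  exact (posSemidef_submatrix_equiv e.symm).1 h

/-- The Halmos dilation: `1 - W Wᴴ` is a projection annihilating `W`, and the defect `1 - Wᴴ W` in
the first corner is zero. Conjugating a block diagonal matrix by it puts the compression by `W` of
the second block into the first corner. -/
lemma isometry_dilation_unitary {W : Matrix κ ι ℂ} (hW : Wᴴ * W = 1) :
    (fromBlocks 0 Wᴴ W (1 - W * Wᴴ))ᴴ * fromBlocks 0 Wᴴ W (1 - W * Wᴴ) = 1 := by
  rw [fromBlocks_conjTranspose, fromBlocks_multiply, ← fromBlocks_one]
  have h : W * Wᴴ * (W * Wᴴ) = W * Wᴴ := by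
    rw [Matrix.mul_assoc, ← Matrix.mul_assoc Wᴴ, hW, Matrix.one_mul]
  congr 1 <;> simp [hW, mul_sub, sub_mul, Matrix.mul_sub, Matrix.sub_mul, h, ← Matrix.mul_assoc]
  simp [Matrix.mul_assoc, hW]

/-- Complete the contraction `V` to an isometry `W`, dilate `W` to a unitary, and realise `Wᴴ
diag(a, d) W` as a corner of a positive matrix `M`. Strictness in `hab` leaves room to dominate `M`
by `diag(b, c)` with `c` large. Operator monotonicity is then applied to this pair, and the corner
of the result is the claim. -/
lemma jensen_aux {f : ℝ → ℝ} (hf0 : ∀ x, 0 < x → 0 < f x) (hf : OperatorMonotone f)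
    {V : Matrix κ ι ℂ} {a : κ → ℝ} {b : ι → ℝ} (ha : ∀ i, 0 < a i) (hb : ∀ i, 0 < b i)
    (hV : (1 - Vᴴ * V).PosSemidef)
    (hab : (realDiag b - Vᴴ * realDiag a * V).PosDef) :
    ((realDiag fun i => f (b i))
      - Vᴴ * (realDiag fun i => f (a i)) * V).PosSemidef := by
  obtain ⟨E, hE⟩ : ∃ E : Matrix ι ι ℂ, 1 - Vᴴ * V = Eᴴ * E :=
    PosSemidef.exists_eq_conjTranspose_mul_self hV
  obtain ⟨d, hd, hd'⟩ := PosDef.exists_posSemidef_sub_smul_one hab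
  set W : Matrix (κ ⊕ ι) ι ℂ := fromRows V E with hWdef
  have hW : Wᴴ * W = 1 := by
    rw [hWdef, conjTranspose_fromRows_eq_fromCols_conjTranspose, fromCols_mul_fromRows, ← hE]; simp
  have hcomp : ∀ (x : κ → ℝ) (t : ℝ),
      Wᴴ * (realDiag (Sum.elim x fun _ => t) : Matrix (κ ⊕ ι) (κ ⊕ ι) ℂ) * W
      = Vᴴ * realDiag x * V + (t : ℂ) • (1 - Vᴴ * V) := by
    intro x t
    have : (realDiag (Sum.elim x fun _ => t) : Matrix (κ ⊕ ι) (κ ⊕ ι) ℂ)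
        = fromBlocks (realDiag x) 0 0 ((t : ℂ) • 1) := by
      rw [smul_one_eq_diagonal, fromBlocks_diagonal]
      funext i; cases i <;> rfl
    rw [this, hWdef, conjTranspose_fromRows_eq_fromCols_conjTranspose, fromCols_mul_fromBlocks,
      fromCols_mul_fromRows, hE]
    simp
  set S := fromBlocks 0 Wᴴ W (1 - W * Wᴴ) with hS
  have hSu : Sᴴ * S = 1 := isometry_dilation_unitary hW
  -- The value `1` on the first block is arbitrary: the zero corner of `S` removes it from the
  -- corner of `M`, and only its positivity matters. The value `d` must be positive, yet small
  -- enough to fit below the gap in `hab`.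
  set g : ι ⊕ (κ ⊕ ι) → ℝ := Sum.elim (fun _ => 1) (Sum.elim a fun _ => d) with hg
  have hgpos : ∀ i, 0 < g i := by rintro (i | i | i) <;> simp [g, ha, hd]
  set M := S * realDiag g * Sᴴ with hM
  have hMpd : M.PosDef := by
    rw [hM, posDef_conj_iff hSu, posDef_diagonal_iff]; exact fun i => by exact_mod_cast hgpos i
  have hcorner : ∀ h : ι ⊕ (κ ⊕ ι) → ℝ, (S * realDiag h * Sᴴ).toBlocks₁₁
      = Wᴴ * (realDiag fun i : κ ⊕ ι => h (.inr i)) * W := by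
    intro h
    have : (realDiag h : Matrix (ι ⊕ (κ ⊕ ι)) (ι ⊕ (κ ⊕ ι)) ℂ)
        = fromBlocks ((realDiag fun i => h (.inl i))) 0 0
          ((realDiag fun i => h (.inr i))) := by
      rw [fromBlocks_diagonal]; funext i; cases i <;> rfl
    rw [this, hS, fromBlocks_conjTranspose, fromBlocks_multiply, fromBlocks_multiply]
    simp
  have hM11 : (realDiag b - M.toBlocks₁₁).PosDef := by
    rw [hM, hcorner]
    simp only [hg, Sum.elim_inr]
    rw [hcomp]
    have : realDiag b - (Vᴴ * realDiag a * V +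
        (d : ℂ) • (1 - Vᴴ * V)) = (realDiag b -
        Vᴴ * realDiag a * V - (d : ℂ) • 1) + (d : ℂ) • (Vᴴ * V) := by
      rw [smul_sub]; abel
    rw [this]
    exact hd'.add_posSemidef ((posSemidef_conjTranspose_mul_self V).smul (by exact_mod_cast hd.le))
  -- `c` dominates exactly what the Schur complement criterion for `diag(b, c) - M` asks of the
  -- second block.
  obtain ⟨c, hc, hc'⟩ := IsHermitian.exists_posSemidef_smul_one_sub
    (A := M.toBlocks₂₂ + M.toBlocks₁₂ᴴ * (realDiag b - M.toBlocks₁₁)⁻¹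
      * M.toBlocks₁₂) (by
      refine IsHermitian.add (hMpd.1.submatrix _) (isHermitian_conjTranspose_mul_mul _ hM11.inv.1))
  set B : ι ⊕ (κ ⊕ ι) → ℝ := Sum.elim b fun _ => c with hB
  have hBpos : ∀ i, 0 < B i := by rintro (i | i) <;> simp [B, hb, hc]
  have hle : (realDiag B - M).PosSemidef := by
    have h21 : M.toBlocks₂₁ = M.toBlocks₁₂ᴴ := by
      ext i j; exact (congrFun (congrFun hMpd.1 _) _).symm
    have : realDiag B - M = fromBlocks
        (realDiag b - M.toBlocks₁₁) (-M.toBlocks₁₂) (-M.toBlocks₁₂)ᴴ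
        ((c : ℂ) • 1 - M.toBlocks₂₂) := by
      conv_lhs => rw [← fromBlocks_toBlocks M, h21]
      have : (realDiag B : Matrix (ι ⊕ (κ ⊕ ι)) (ι ⊕ (κ ⊕ ι)) ℂ)
          = fromBlocks (realDiag b) 0 0 ((c : ℂ) • 1) := by
        rw [smul_one_eq_diagonal, fromBlocks_diagonal]; funext i; cases i <;> rfl
      rw [this, sub_eq_add_neg, fromBlocks_neg, fromBlocks_add]
      simp [sub_eq_add_neg]
    rw [this]
    have := hM11.isUnit.invertible
    rw [PosDef.fromBlocks₁₁ _ _ hM11]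
    simpa [sub_sub] using hc'
  have hfin := hf.posSemidef_cfc_sub hMpd
    (posDef_diagonal_iff.2 fun i => by exact_mod_cast hBpos i) hle
  rw [hM, cfc_conj_realDiag f hSu, cfc_realDiag] at hfin
  have h11 := hfin.submatrix Sum.inl
  have key : ((realDiag fun i => f (B i)) - S * (realDiag fun i => f (g i)) * Sᴴ).submatrix
      Sum.inl Sum.inl = (realDiag fun i => f (b i)) -
        (Vᴴ * (realDiag fun i => f (a i)) * V + (f d : ℂ) • (1 - Vᴴ * V)) := by
    rw [← hcomp (fun i => f (a i)) (f d)]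
    have h1 := hcorner (fun i => f (g i))
    have h2 : (realDiag fun i : κ ⊕ ι => f (g (.inr i))) =
        realDiag (Sum.elim (fun i => f (a i)) fun _ => f d) := by
      funext i; cases i <;> rfl
    rw [← h2, ← h1]
    ext i j
    simp [toBlocks₁₁, diagonal_apply, B]
  rw [key] at h11
  -- The padding by `d` costs the term `f d • (1 - Vᴴ V)`, which may be dropped because `f` is
  -- positive.
  have := h11.add (hV.smul (a := (f d : ℂ)) (by exact_mod_cast (hf0 d hd).le))
  convert this using 1
  abel

/-- Operator Jensen inequality for a positive operator monotone function and a contraction. -/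
lemma OperatorMonotone.posSemidef_sub_conj {f : ℝ → ℝ} (hf0 : ∀ x, 0 < x → 0 < f x)
    (hf : OperatorMonotone f)
    {V : Matrix κ ι ℂ} {a : κ → ℝ} {b : ι → ℝ} (ha : ∀ i, 0 < a i) (hb : ∀ i, 0 < b i)
    (hV : (1 - Vᴴ * V).PosSemidef)
    (hab : (realDiag b - Vᴴ * realDiag a * V).PosSemidef) :
    ((realDiag fun i => f (b i))
      - Vᴴ * (realDiag fun i => f (a i)) * V).PosSemidef := by
  -- Shrinking `V` to `s V` makes the hypothesis strict because `b` is positive. Since `a` and `b`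
  -- stay fixed, the limit `s → 1` needs no continuity of `f`.
  have hs : ∀ s : ℝ, 0 < s → s < 1 → ((realDiag fun i => f (b i))
      - ((s ^ 2 : ℝ) : ℂ) • (Vᴴ * (realDiag fun i => f (a i)) * V)).PosSemidef := by
    intro s hs hs1
    have hsq : s ^ 2 < 1 := by nlinarith
    have hconj : ∀ M : Matrix κ κ ℂ, ((s : ℂ) • V)ᴴ * M * ((s : ℂ) • V)
        = ((s ^ 2 : ℝ) : ℂ) • (Vᴴ * M * V) := by
      intro M
      simp only [conjTranspose_smul, Matrix.smul_mul, Matrix.mul_smul, smul_smul]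
      congr 1
      simp [pow_two]
    have h := jensen_aux hf0 hf (V := (s : ℂ) • V) ha hb ?_ ?_
    · rwa [hconj] at h
    · have h1 : 1 - ((s : ℂ) • V)ᴴ * ((s : ℂ) • V)
          = ((1 - s ^ 2 : ℝ) : ℂ) • (1 : Matrix ι ι ℂ) + ((s ^ 2 : ℝ) : ℂ) • (1 - Vᴴ * V) := by
        have := hconj 1
        rw [Matrix.mul_one, Matrix.mul_one] at this
        rw [this, smul_sub, Complex.ofReal_sub, sub_smul]; simp
      rw [h1]
      exact (PosSemidef.one.smul (by exact_mod_cast (sub_pos.2 hsq).le)).add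
        (hV.smul (by exact_mod_cast sq_nonneg s))
    · have h1 : realDiag b - ((s : ℂ) • V)ᴴ * realDiag a * ((s : ℂ) • V)
          = ((1 - s ^ 2 : ℝ) : ℂ) • realDiag b
            + ((s ^ 2 : ℝ) : ℂ) • (realDiag b - Vᴴ * realDiag a * V) := by
        rw [hconj, smul_sub, Complex.ofReal_sub, sub_smul]; simp
      rw [h1]
      refine PosDef.add_posSemidef (PosDef.smul (posDef_diagonal_iff.2 fun i => ?_) ?_)
        (hab.smul (by exact_mod_cast sq_nonneg s))
      · exact_mod_cast hb i
      · exact_mod_cast sub_pos.2 hsq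
  refine .of_dotProduct_mulVec_nonneg ?_ fun x => ?_
  · exact (isHermitian_realDiag _).sub
      (isHermitian_conjTranspose_mul_mul _ (isHermitian_realDiag _))
  · have hcont : Continuous fun s : ℝ => star x ⬝ᵥ (((realDiag fun i => f (b i))
      - ((s ^ 2 : ℝ) : ℂ) • (Vᴴ * (realDiag fun i => f (a i)) * V)) *ᵥ x) := by
      simp only [sub_mulVec, smul_mulVec, dotProduct_sub, dotProduct_smul]
      fun_prop
    have hlim := hcont.continuousWithinAt (s := Set.Ioo 0 1) (x := (1 : ℝ))
    have hcl : (1 : ℝ) ∈ closure (Set.Ioo (0 : ℝ) 1) := by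
      rw [closure_Ioo zero_ne_one]; simp
    have := (isClosed_Ici (a := (0 : ℂ))).closure_subset_iff.2
      (Set.image_subset_iff.2 fun s hs' => Set.mem_Ici.2
        ((hs s hs'.1 hs'.2).dotProduct_mulVec_nonneg x)) (hlim.mem_closure_image hcl)
    simpa using this

end Jensen

/-! ### The Petz form in an eigenbasis of the base point. -/

section PetzForm

variable {n : ℕ}

lemma realDiag_mul_single (a : Fin n → ℝ) (i j : Fin n) (x : ℂ) :
    realDiag a * single i j x = (a i : ℂ) • single i j x := by
  ext k l
  by_cases h : i = k <;> simp [diagonal_mul, single_apply, h]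

lemma single_mul_realDiag (a : Fin n → ℝ) (i j : Fin n) (x : ℂ) :
    single i j x * realDiag a = (a j : ℂ) • single i j x := by
  ext k l
  by_cases h : j = l <;> simp [mul_diagonal, single_apply, h, mul_comm]

lemma ringInverse_eq_of_mul_eq_one {R : Type*} [MonoidWithZero R] {a b : R} (h : a * b = 1)
    (h' : b * a = 1) : Ring.inverse a = b :=
  Ring.inverse_unit (⟨a, b, h, h'⟩ : Rˣ)

lemma ringInverse_superR {ρ : Op n} (hρ : ρ.PosDef) : Ring.inverse (superR ρ) = superR ρ⁻¹ := by
  have h : IsUnit ρ.det := (isUnit_iff_isUnit_det _).1 hρ.isUnit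
  refine ringInverse_eq_of_mul_eq_one ?_ ?_ <;> ext1 X <;>
    simp [superR, Matrix.mul_assoc, nonsing_inv_mul _ h, mul_nonsing_inv _ h]

/-- In the basis of matrix units the matrix is the Kronecker product of `ρ` and the transpose of
`σ`. Hermiticity is needed because `cfc` returns a default value on matrices that are not
self-adjoint. -/
lemma isHermitian_toMatrix_superL_mul_superR {ρ σ : Op n} (hρ : ρ.IsHermitian)
    (hσ : σ.IsHermitian) :
    (LinearMap.toMatrix (stdBasis ℂ (Fin n) (Fin n)) (stdBasis ℂ (Fin n) (Fin n))
      (superL ρ * superR σ)).IsHermitian := by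
  have h : ∀ k l i j, LinearMap.toMatrix (stdBasis ℂ (Fin n) (Fin n)) (stdBasis ℂ (Fin n) (Fin n))
      (superL ρ * superR σ) (k, l) (i, j) = ρ k i * σ j l := by
    intro k l i j
    rw [LinearMap.toMatrix_apply, stdBasis_eq_single]
    change (ρ * (single i j (1 : ℂ) * σ) : Matrix (Fin n) (Fin n) ℂ) k l = _
    rw [mul_apply, Finset.sum_eq_single i, single_mul_apply_same, one_mul]
    · intro b _ hb
      rw [single_mul_apply_of_ne _ _ _ _ _ hb, mul_zero]
    · simp
  ext ⟨i, j⟩ ⟨k, l⟩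
  rw [conjTranspose_apply, h, h, star_mul', hρ.apply, hσ.apply]

lemma aeval_apply_of_apply_eq_smul {S : Module.End ℂ (Op n)} {X : Op n} {x : ℝ}
    (h : S X = (x : ℂ) • X) (p : ℝ[X]) : aeval S p X = ((p.eval x : ℝ) : ℂ) • X := by
  induction p using Polynomial.induction_on' with
  | add p q hp hq => simp [hp, hq, add_smul]
  | monomial k a =>
    have hk : ∀ k : ℕ, (S ^ k) X = ((x : ℂ) ^ k) • X := by
      intro k
      induction k with
      | zero => simp
      | succ k ih => rw [pow_succ, Module.End.mul_apply, h, map_smul, ih, smul_smul, pow_succ']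
    rw [aeval_monomial, Module.End.mul_apply, hk, eval_monomial,
      Module.algebraMap_end_apply, Complex.ofReal_mul, Complex.ofReal_pow, mul_smul]
    rfl

/-- The functional calculus of a superoperator acts on eigenvectors by the function values. -/
lemma superCfc_apply_of_apply_eq_smul (f : ℝ → ℝ) {S : Module.End ℂ (Op n)}
    (hS : (LinearMap.toMatrix (stdBasis ℂ (Fin n) (Fin n)) (stdBasis ℂ (Fin n) (Fin n))
      S).IsHermitian) {X : Op n} {x : ℝ} (h : S X = (x : ℂ) • X) :
    superCfc f S X = (f x : ℂ) • X := by
  obtain ⟨p, hp⟩ := exists_polynomial_eval_eq f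
    ((Matrix.finite_real_spectrum (A := LinearMap.toMatrix (stdBasis ℂ (Fin n) (Fin n))
      (stdBasis ℂ (Fin n) (Fin n)) S)).union (Set.finite_singleton x))
  have h1 : superCfc f S = aeval S p := by
    rw [superCfc, cfc_eq_aeval hS fun x hx => hp x (Or.inl hx)]
    have := Polynomial.aeval_algHom_apply
      (((LinearMap.toMatrixAlgEquiv (stdBasis ℂ (Fin n) (Fin n))).toAlgHom).restrictScalars ℝ) S p
    change aeval (LinearMap.toMatrix (stdBasis ℂ (Fin n) (Fin n)) (stdBasis ℂ (Fin n) (Fin n)) S) p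
      = LinearMap.toMatrix (stdBasis ℂ (Fin n) (Fin n)) (stdBasis ℂ (Fin n) (Fin n)) (aeval S p)
      at this
    rw [this, Matrix.toLin_toMatrix]
  rw [h1, aeval_apply_of_apply_eq_smul h, hp x (Or.inr rfl)]

/-- Entrywise multiplication by `w` in the basis given by the unitary `U`. -/
def entrywiseMul (U : Op n) (w : Fin n → Fin n → ℂ) : Module.End ℂ (Op n) where
  toFun X := U * of (fun i j => w i j * (Uᴴ * X * U) i j) * Uᴴ
  map_add' X Y := by
    rw [← add_mul, ← mul_add]; congr 2; ext; simp [mul_add, add_mul]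
  map_smul' c X := by
    rw [RingHom.id_apply, ← smul_mul_assoc, ← mul_smul_comm]; congr 2; ext; simp; ring

lemma entrywiseMul_apply (U : Op n) (w : Fin n → Fin n → ℂ) (X : Op n) :
    entrywiseMul U w X = U * of (fun i j => w i j * (Uᴴ * X * U) i j) * Uᴴ := rfl

lemma conj_mul_conj_cancel {U : Op n} (hU : Uᴴ * U = 1) (X : Op n) :
    Uᴴ * (U * X * Uᴴ) * U = X := by
  rw [mul_assoc, mul_assoc, hU, mul_one, ← mul_assoc, hU, one_mul]

lemma entrywiseMul_mul {U : Op n} (hU : Uᴴ * U = 1) {w v : Fin n → Fin n → ℂ}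
    (h : ∀ i j, w i j * v i j = 1) : entrywiseMul U w * entrywiseMul U v = 1 := by
  ext1 X
  rw [Module.End.mul_apply, entrywiseMul_apply, entrywiseMul_apply, conj_mul_conj_cancel hU]
  simp only [of_apply, ← mul_assoc, h, one_mul]
  have h1 : U * Uᴴ = 1 := mul_eq_one_comm.1 hU
  change U * (Uᴴ * X * U) * Uᴴ = X
  rw [mul_assoc, mul_assoc, h1, mul_one, ← mul_assoc, h1, one_mul]

variable {f : ℝ → ℝ} {U ρ : Op n} {a : Fin n → ℝ}

/-- The matrices `U eᵢⱼ Uᴴ` are common eigenvectors: `L_ρ` acts by `a i`, `R_ρ` by `a j`, hence `L_ρ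
R_ρ⁻¹` by the ratio. -/
lemma superR_mul_superCfc_eq (f : ℝ → ℝ) (hU : Uᴴ * U = 1) (ha : ∀ i, 0 < a i)
    (hρ : ρ = U * realDiag a * Uᴴ) :
    superR ρ * superCfc f (superL ρ * Ring.inverse (superR ρ))
      = entrywiseMul U fun i j => ((a j * f (a i / a j) : ℝ) : ℂ) := by
  have hρd : ρ.PosDef := by
    rw [hρ, posDef_conj_iff hU, posDef_diagonal_iff]; exact fun i => by exact_mod_cast ha i
  have h1 : U * Uᴴ = 1 := mul_eq_one_comm.1 hU
  have hinv : ρ⁻¹ = U * realDiag (fun i => (a i)⁻¹) * Uᴴ := by rw [hρ, conj_realDiag_inv hU ha]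
  rw [ringInverse_superR hρd]
  have key : ∀ Z : Op n, (superR ρ * superCfc f (superL ρ * superR ρ⁻¹)) (U * Z * Uᴴ)
      = entrywiseMul U (fun i j => ((a j * f (a i / a j) : ℝ) : ℂ)) (U * Z * Uᴴ) := by
    intro Z
    induction Z using Matrix.induction_on' with
    | h_zero => simp
    | h_add p q hp hq => rw [mul_add, add_mul, map_add, map_add, hp, hq]
    | h_std_basis i j x =>
      have hl : ρ * (U * single i j x * Uᴴ) = (a i : ℂ) • (U * single i j x * Uᴴ) := by
        rw [hρ]
        calc U * realDiag a * Uᴴ * (U * single i j x * Uᴴ)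
            = U * (realDiag a * (Uᴴ * U) * single i j x) * Uᴴ := by simp only [mul_assoc]
          _ = _ := by
            rw [hU, mul_one, realDiag_mul_single, mul_smul_comm, smul_mul_assoc]
      have hr : ∀ b : Fin n → ℝ, (U * single i j x * Uᴴ) * (U * realDiag b * Uᴴ)
          = (b j : ℂ) • (U * single i j x * Uᴴ) := by
        intro b
        calc (U * single i j x * Uᴴ) * (U * realDiag b * Uᴴ)
            = U * (single i j x * (Uᴴ * U) * realDiag b) * Uᴴ := by simp only [mul_assoc]
          _ = _ := by
            rw [hU, mul_one, single_mul_realDiag, mul_smul_comm, smul_mul_assoc]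
      have hS : (superL ρ * superR ρ⁻¹) (U * single i j x * Uᴴ)
          = ((a i / a j : ℝ) : ℂ) • (U * single i j x * Uᴴ) := by
        change ρ * ((U * single i j x * Uᴴ) * ρ⁻¹) = _
        rw [hinv, hr, mul_smul_comm, hl, smul_smul, ← Complex.ofReal_mul, div_eq_inv_mul]
      rw [Module.End.mul_apply, superCfc_apply_of_apply_eq_smul f
        (isHermitian_toMatrix_superL_mul_superR hρd.1 hρd.inv.1) hS, map_smul]
      change (f (a i / a j) : ℂ) • ((U * single i j x * Uᴴ) * ρ) = _
      rw [entrywiseMul_apply, conj_mul_conj_cancel hU, hρ, hr, smul_smul, ← smul_mul_assoc,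
        ← mul_smul_comm]
      congr 2
      ext k l
      by_cases hkl : i = k ∧ j = l
      · obtain ⟨rfl, rfl⟩ := hkl
        simp only [Matrix.smul_apply, single_apply_same, of_apply, smul_eq_mul]
        push_cast; ring
      · simp [single_apply_of_ne _ _ _ _ _ hkl]
  ext1 X
  have := key (Uᴴ * X * U)
  have hX : U * (Uᴴ * X * U) * Uᴴ = X := by
    rw [mul_assoc, mul_assoc, h1, mul_one, ← mul_assoc, h1, one_mul]
  rwa [hX] at this

lemma trace_conjTranspose_mul (A B : Op n) :
    (Aᴴ * B).trace = ∑ i, ∑ j, star (A i j) * B i j := by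
  rw [Finset.sum_comm]
  simp [trace, mul_apply]

/-- The Petz form in an eigenbasis of `ρ`. -/
lemma petzForm_eq_sum (hf : ∀ x, 0 < x → 0 < f x) (hU : Uᴴ * U = 1) (ha : ∀ i, 0 < a i)
    (hρ : ρ = U * realDiag a * Uᴴ) (X Y : Op n) :
    petzForm f ρ X Y = ∑ i, ∑ j, star ((Uᴴ * X * U) i j) * (Uᴴ * Y * U) i j *
      (((a j * f (a i / a j))⁻¹ : ℝ) : ℂ) := by
  have hw : ∀ i j, a j * f (a i / a j) ≠ 0 := fun i j =>
    (mul_pos (ha j) (hf _ (div_pos (ha i) (ha j)))).ne'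
  rw [petzForm, superR_mul_superCfc_eq f hU ha hρ, ringInverse_eq_of_mul_eq_one
    (b := entrywiseMul U fun i j => (((a j * f (a i / a j))⁻¹ : ℝ) : ℂ))
    (entrywiseMul_mul hU fun i j => by rw [← Complex.ofReal_mul, mul_inv_cancel₀ (hw i j)]; simp)
    (entrywiseMul_mul hU fun i j => by rw [← Complex.ofReal_mul, inv_mul_cancel₀ (hw i j)]; simp),
    entrywiseMul_apply, ← mul_assoc, trace_mul_comm, ← mul_assoc, ← mul_assoc]
  have : Uᴴ * Xᴴ * U = (Uᴴ * X * U)ᴴ := by simp [mul_assoc]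
  rw [this, trace_conjTranspose_mul]
  refine Finset.sum_congr rfl fun i _ => Finset.sum_congr rfl fun j _ => ?_
  rw [of_apply]; ring

lemma petzForm_realDiag (hf : ∀ x, 0 < x → 0 < f x) (ha : ∀ i, 0 < a i) (X Y : Op n) :
    petzForm f (realDiag a) X Y = ∑ i, ∑ j, star (X i j) * Y i j *
      (((a j * f (a i / a j))⁻¹ : ℝ) : ℂ) := by
  simpa using petzForm_eq_sum (U := 1) hf (by simp) ha (by simp) X Y

lemma petzForm_conj (hf : ∀ x, 0 < x → 0 < f x) (hU : Uᴴ * U = 1) (ha : ∀ i, 0 < a i)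
    (X Y : Op n) : petzForm f (U * realDiag a * Uᴴ) X Y
      = petzForm f (realDiag a) (Uᴴ * X * U) (Uᴴ * Y * U) := by
  rw [petzForm_eq_sum hf hU ha rfl, petzForm_realDiag hf ha]

lemma petzForm_realDiag_self (hf : ∀ x, 0 < x → 0 < f x) (ha : ∀ i, 0 < a i) (X : Op n) :
    petzForm f (realDiag a) X X
      = ((∑ i, ∑ j, Complex.normSq (X i j) * (a j * f (a i / a j))⁻¹ : ℝ) : ℂ) := by
  rw [petzForm_realDiag hf ha]
  push_cast
  simp only [Complex.normSq_eq_conj_mul_self, Complex.star_def]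

end PetzForm

/-! ### Kraus representations of CPTNI maps. -/

section Kraus

variable {n m : ℕ} {ι : Type*} [Fintype ι]

/-- The map `X ↦ ∑ k, Aₖ X Aₖᴴ`. -/
def krausMap (A : ι → Matrix (Fin m) (Fin n) ℂ) : Op n →ₗ[ℂ] Op m where
  toFun X := ∑ k, A k * X * (A k)ᴴ
  map_add' X Y := by simp [Matrix.mul_add, Matrix.add_mul, Finset.sum_add_distrib]
  map_smul' c X := by simp [Finset.smul_sum]

lemma krausMap_apply (A : ι → Matrix (Fin m) (Fin n) ℂ) (X : Op n) :
    krausMap A X = ∑ k, A k * X * (A k)ᴴ := rfl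

lemma trace_krausMap (A : ι → Matrix (Fin m) (Fin n) ℂ) (X : Op n) :
    (krausMap A X).trace = ((∑ k, (A k)ᴴ * A k) * X).trace := by
  rw [krausMap_apply, trace_sum, Finset.sum_mul, trace_sum]
  refine Finset.sum_congr rfl fun k _ => ?_
  rw [trace_mul_comm, Matrix.mul_assoc]

lemma PosSemidef.trace_mul_re_nonneg {κ : Type*} [Fintype κ] [DecidableEq κ]
    {X Y : Matrix κ κ ℂ} (hX : X.PosSemidef) (hY : Y.PosSemidef) : 0 ≤ (X * Y).trace.re := by
  obtain ⟨E, rfl⟩ := PosSemidef.exists_eq_conjTranspose_mul_self hY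
  rw [← Matrix.mul_assoc, trace_mul_comm, ← Matrix.mul_assoc]
  exact (Complex.le_def.1 (hX.mul_mul_conjTranspose_same E).trace_nonneg).1

/-- A Gram product of `n × m` factors is rewritten as a sum of Gram products of square `m × m`
factors, so that positivity can be read inside the C⋆-algebra `Op m`. -/
lemma sum_conjTranspose_mul_mul_eq {κ : Type*} [Fintype κ] {S : κ → Matrix (Fin m) (Fin n) ℂ}
    (hS : ∑ p, (S p)ᴴ * S p = 1) (A : Matrix (Fin m) (Fin n) ℂ) (Y Z : Matrix (Fin n) (Fin n) ℂ) :
    ∑ p, (S p * Y * Aᴴ)ᴴ * (S p * Z * Aᴴ) = A * (Yᴴ * Z) * Aᴴ := by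
  have h : ∀ p, (S p * Y * Aᴴ)ᴴ * (S p * Z * Aᴴ) = A * Yᴴ * ((S p)ᴴ * S p) * (Z * Aᴴ) := by
    intro p
    simp only [conjTranspose_mul, conjTranspose_conjTranspose, Matrix.mul_assoc]
  simp only [h]
  rw [← Matrix.sum_mul, ← Matrix.mul_sum, hS, Matrix.mul_one]
  simp only [Matrix.mul_assoc]

lemma cstarMatrix_sum_apply {κ k A : Type*} [Fintype κ] [AddCommMonoid A]
    (F : κ → CStarMatrix k k A) (i j : k) : (∑ x, F x) i j = ∑ x, F x i j :=
  map_sum (AddMonoidHom.mk (ZeroHom.mk (fun M : CStarMatrix k k A => M i j) rfl)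
    fun _ _ => rfl) F _

lemma nonneg_iff_exists_star_mul_self {B : Type*} [NonUnitalCStarAlgebra B] [PartialOrder B]
    [StarOrderedRing B] {b : B} : 0 ≤ b ↔ ∃ c, b = star c * c :=
  CStarAlgebra.nonneg_iff_eq_star_mul_self

open scoped MatrixOrder Matrix.Norms.L2Operator CStarAlgebra in
lemma isCompletelyPositive_krausMap (A : ι → Matrix (Fin m) (Fin n) ℂ) :
    IsCompletelyPositive (krausMap A) := by
  refine ⟨⟨krausMap A, fun k M hM => ?_⟩, rfl⟩
  rcases Nat.eq_zero_or_pos m with rfl | hm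
  · refine le_of_eq ?_
    ext i j a
    exact a.elim0
  obtain ⟨N, rfl⟩ := nonneg_iff_exists_star_mul_self.1 hM
  let q : Fin m := ⟨0, hm⟩
  let E : Fin k → Fin k → Matrix (Fin n) (Fin n) ℂ := fun i j => N i j
  -- `S p` moves row `p` of an `n`-row matrix into the fixed row `q` of an `m`-row matrix.
  let S : Fin n → Matrix (Fin m) (Fin n) ℂ := fun p => single q p 1
  have hS : ∑ p, (S p)ᴴ * S p = 1 := by simp [S, sum_single_one]
  let D : ι → Fin n → CStarMatrix (Fin k) (Fin k) (Op m) := fun a p =>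
    CStarMatrix.ofMatrix (Matrix.of fun i j => S p * E i j * (A a)ᴴ)
  have : (star N * N).map (krausMap A) = ∑ a, ∑ p, star (D a p) * D a p := by
    ext1 i j
    have hD : ∀ a p, (star (D a p) * D a p) i j
        = ∑ l, (S p * E l i * (A a)ᴴ)ᴴ * (S p * E l j * (A a)ᴴ) := by
      intro a p
      rw [CStarMatrix.mul_apply]
      rfl
    have hN : (star N * N) i j = ∑ l, (E l i)ᴴ * E l j := by
      rw [CStarMatrix.mul_apply]
      rfl
    refine Eq.trans ?_ ((cstarMatrix_sum_apply _ i j).trans (Finset.sum_congr rfl fun a _ =>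
      (cstarMatrix_sum_apply _ i j).trans (Finset.sum_congr rfl fun p _ => hD a p))).symm
    rw [CStarMatrix.map_apply, krausMap_apply, hN]
    refine Finset.sum_congr rfl fun a _ => ?_
    rw [Finset.sum_comm, Matrix.mul_sum, Matrix.sum_mul]
    exact Finset.sum_congr rfl fun l _ => (sum_conjTranspose_mul_mul_eq hS (A a) _ _).symm
  change 0 ≤ (star N * N).map (krausMap A)
  rw [this]
  exact Finset.sum_nonneg fun a _ => Finset.sum_nonneg fun p _ => star_mul_self_nonneg _

lemma isCPTNI_krausMap {A : ι → Matrix (Fin m) (Fin n) ℂ}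
    (hA : (1 - ∑ k, (A k)ᴴ * A k).PosSemidef) : IsCPTNI (krausMap A) where
  completelyPositive := isCompletelyPositive_krausMap A
  trace_le X hX := by
    have := PosSemidef.trace_mul_re_nonneg hA hX
    rw [sub_mul, trace_sub, Matrix.one_mul, ← trace_krausMap, Complex.sub_re] at this
    linarith

-- Choi's argument: the matrix `M` of matrix units satisfies `Mᴴ M = n M`, so its image under the
-- amplified map is a Gram product `Cᴴ C`, and the rows of the entries of `C` give the Kraus
-- operators. The factor `n` accounts for the normalisation `1/√n`.
open scoped MatrixOrder Matrix.Norms.L2Operator CStarAlgebra in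
lemma IsCompletelyPositive.exists_eq_krausMap {T : Op n →ₗ[ℂ] Op m}
    (hT : IsCompletelyPositive T) :
    ∃ A : Fin n × Fin m → Matrix (Fin m) (Fin n) ℂ, T = krausMap A := by
  obtain ⟨φ, rfl⟩ := hT
  rcases Nat.eq_zero_or_pos n with rfl | hn
  · exact ⟨fun _ => 0, LinearMap.ext fun X => by simp [Subsingleton.elim X 0]⟩
  let M : CStarMatrix (Fin n) (Fin n) (Op n) :=
    CStarMatrix.ofMatrix (Matrix.of fun i j => single i j 1)
  have hM : ∀ i j, (star M * M) i j = (n : ℂ) • single i j 1 := by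
    intro i j
    rw [CStarMatrix.mul_apply]
    have : ∀ l, (star M) i l * M l j = single i j 1 := by
      intro l
      rw [CStarMatrix.star_apply]
      change (single l i (1 : ℂ))ᴴ * single l j (1 : ℂ) = _
      simp
    simp [this]
  obtain ⟨C, hC⟩ := nonneg_iff_exists_star_mul_self.1
    (φ.map_cstarMatrix_nonneg' n (star M * M) (star_mul_self_nonneg M))
  have hC' : ∀ i j, (n : ℂ) • φ.toLinearMap (single i j 1) = ∑ l, (C l i)ᴴ * C l j := by
    intro i j
    rw [← map_smul, ← hM]
    change ((star M * M).map φ.toLinearMap) i j = _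
    have : (star M * M).map φ.toLinearMap = star C * C := hC
    rw [this, CStarMatrix.mul_apply]
    rfl
  refine ⟨fun p => of fun b i => ((√n : ℝ) : ℂ)⁻¹ * star (C p.1 i p.2 b), ?_⟩
  refine Matrix.ext_linearMap ℂ fun i j => LinearMap.ext_ring ?_
  ext b c
  have h := congrFun (congrFun (hC' i j) b) c
  have hn' : (n : ℂ) ≠ 0 := by exact_mod_cast hn.ne'
  have hs : ((√n : ℝ) : ℂ)⁻¹ * ((√n : ℝ) : ℂ)⁻¹ = (n : ℂ)⁻¹ := by
    rw [← mul_inv, ← Complex.ofReal_mul, Real.mul_self_sqrt n.cast_nonneg]; simp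
  refine mul_left_cancel₀ hn' (h.trans ?_)
  change _ = (n : ℂ) * (krausMap (fun p : Fin n × Fin m =>
    (of fun b i => ((√n : ℝ) : ℂ)⁻¹ * star (C p.1 i p.2 b) : Matrix (Fin m) (Fin n) ℂ))
      (single i j 1)) b c
  rw [krausMap_apply]
  simp only [Matrix.sum_apply, mul_apply, conjTranspose_apply, Fintype.sum_prod_type,
    Finset.mul_sum]
  simp only [single_apply, ite_and, mul_ite, mul_one, mul_zero, Finset.sum_ite_eq, Finset.mem_univ,
    if_true, of_apply, ite_mul, zero_mul]
  refine Finset.sum_congr rfl fun l _ => Finset.sum_congr rfl fun q _ => ?_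
  have hst : star (((√n : ℝ) : ℂ)⁻¹) = ((√n : ℝ) : ℂ)⁻¹ := by
    rw [star_inv₀, Complex.star_def, Complex.conj_ofReal]
  rw [star_mul', star_star, hst]
  calc star (C l i q b) * C l j q c
      = (n : ℂ) * (n : ℂ)⁻¹ * (star (C l i q b) * C l j q c) := by rw [mul_inv_cancel₀ hn', one_mul]
    _ = _ := by rw [← hs]; ring

lemma IsCPTNI.exists_eq_krausMap {T : Op n →ₗ[ℂ] Op m} (hT : IsCPTNI T) :
    ∃ A : Fin n × Fin m → Matrix (Fin m) (Fin n) ℂ,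
      (1 - ∑ k, (A k)ᴴ * A k).PosSemidef ∧ T = krausMap A := by
  obtain ⟨A, rfl⟩ := hT.completelyPositive.exists_eq_krausMap
  refine ⟨A, ?_, rfl⟩
  have hherm : (1 - ∑ k, (A k)ᴴ * A k).IsHermitian :=
    isHermitian_one.sub (posSemidef_sum _ fun k _ => posSemidef_conjTranspose_mul_self (A k)).1
  refine .of_dotProduct_mulVec_nonneg hherm fun x => ?_
  -- On the rank one operator `x xᴴ` the trace condition is the quadratic form of `1 - ∑ Aₖᴴ Aₖ` at
  -- `x`.
  have h := hT.trace_le _ (posSemidef_vecMulVec_self_star x)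
  have him : (star x ⬝ᵥ ((1 - ∑ k, (A k)ᴴ * A k) *ᵥ x)).im = 0 :=
    hherm.im_star_dotProduct_mulVec_self x
  refine Complex.le_def.2 ⟨?_, him.symm⟩
  have hx : star x ⬝ᵥ ((1 - ∑ k, (A k)ᴴ * A k) *ᵥ x)
      = ((1 - ∑ k, (A k)ᴴ * A k) * vecMulVec x (star x)).trace := by
    rw [mul_vecMulVec, trace_vecMulVec, dotProduct_comm]
  rw [hx, sub_mul, trace_sub, Matrix.one_mul, ← trace_krausMap]
  simpa using h

end Kraus

/-! ### Petz forms of operator monotone functions are monotone metrics. -/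

section Sufficiency

variable {n m : ℕ} {ι : Type*} [Fintype ι]

lemma realDiag_one {κ : Type*} [DecidableEq κ] : (realDiag fun _ : κ => 1) = 1 := by
  ext; simp [diagonal_apply, one_apply]

lemma dotProduct_realDiag_mulVec {κ : Type*} [Fintype κ] [DecidableEq κ] (d : κ → ℝ) (y : κ → ℂ) :
    star y ⬝ᵥ (realDiag d *ᵥ y) = ((∑ i, d i * Complex.normSq (y i) : ℝ) : ℂ) := by
  simp only [dotProduct, mulVec_diagonal, Pi.star_apply]
  push_cast
  refine Finset.sum_congr rfl fun i _ => ?_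
  rw [Complex.normSq_eq_conj_mul_self, Complex.star_def]; ring

lemma posSemidef_realDiag_sub_iff {κ μ : Type*} [Fintype κ] [DecidableEq κ] [Fintype μ]
    [DecidableEq μ] {V : Matrix κ μ ℂ} {d : μ → ℝ} {e : κ → ℝ} :
    (realDiag d - Vᴴ * realDiag e * V).PosSemidef ↔
      ∀ y : μ → ℂ, ∑ i, e i * Complex.normSq ((V *ᵥ y) i) ≤ ∑ i, d i * Complex.normSq (y i) := by
  have h : ∀ y : μ → ℂ, star y ⬝ᵥ ((realDiag d - Vᴴ * realDiag e * V) *ᵥ y)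
      = ((∑ i, d i * Complex.normSq (y i) - ∑ i, e i * Complex.normSq ((V *ᵥ y) i) : ℝ) : ℂ) := by
    intro y
    rw [sub_mulVec, dotProduct_sub, dotProduct_realDiag_mulVec, ← mulVec_mulVec, ← mulVec_mulVec,
      dotProduct_mulVec, ← star_mulVec, dotProduct_realDiag_mulVec, Complex.ofReal_sub]
  rw [posSemidef_iff_dotProduct_mulVec]
  simp only [h, Complex.zero_le_real, sub_nonneg]
  exact and_iff_right ((isHermitian_realDiag _).sub
    (isHermitian_conjTranspose_mul_mul _ (isHermitian_realDiag _)))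

lemma re_trace_realDiag_mul (a : Fin n → ℝ) (Z : Matrix (Fin m) (Fin n) ℂ) :
    (realDiag a * (Zᴴ * Z)).trace.re = ∑ i, ∑ j, a j * Complex.normSq (Z i j) := by
  rw [Finset.sum_comm]
  simp only [trace, diag_apply, diagonal_mul, Complex.re_sum]
  simp only [mul_apply, conjTranspose_apply, Complex.re_sum, Finset.mul_sum]
  refine Finset.sum_congr rfl fun j _ => Finset.sum_congr rfl fun i _ => ?_
  rw [Complex.star_def, ← Complex.normSq_eq_conj_mul_self, ← Complex.ofReal_mul, Complex.ofReal_re]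

/-- The Hilbert-Schmidt adjoint `Y ↦ ∑ k, Aₖᴴ Y Aₖ` of a Kraus map. -/
def krausAdj (A : ι → Matrix (Fin m) (Fin n) ℂ) (Y : Op m) : Op n := ∑ k, (A k)ᴴ * Y * A k

lemma krausAdj_conjTranspose (A : ι → Matrix (Fin m) (Fin n) ℂ) (Y : Op m) :
    krausAdj A Yᴴ = (krausAdj A Y)ᴴ := by
  simp [krausAdj, conjTranspose_sum, Matrix.mul_assoc]

lemma trace_krausAdj_mul (A : ι → Matrix (Fin m) (Fin n) ℂ) (Y : Op m) (X : Op n) :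
    (krausAdj A Y * X).trace = (Y * krausMap A X).trace := by
  rw [krausAdj, krausMap_apply, Finset.sum_mul, Finset.mul_sum, trace_sum, trace_sum]
  refine Finset.sum_congr rfl fun k _ => ?_
  rw [Matrix.mul_assoc, Matrix.mul_assoc, trace_mul_comm]
  simp only [Matrix.mul_assoc]

/-- The Kadison-Schwarz inequality for the adjoint of a trace-non-increasing Kraus map. -/
lemma posSemidef_krausAdj_sub {A : ι → Matrix (Fin m) (Fin n) ℂ}
    (hA : (1 - ∑ k, (A k)ᴴ * A k).PosSemidef) (Y : Op m) :
    (krausAdj A (Yᴴ * Y) - (krausAdj A Y)ᴴ * krausAdj A Y).PosSemidef := by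
  set Z := krausAdj A Y with hZ
  -- Completing squares: the cross terms sum to `-2 Zᴴ Z`, and the defect `1 - ∑ Aₖᴴ Aₖ` absorbs the
  -- failure of `T*` to be unital.
  have h : krausAdj A (Yᴴ * Y) - Zᴴ * Z = ∑ k, (Y * A k - A k * Z)ᴴ * (Y * A k - A k * Z)
      + Zᴴ * (1 - ∑ k, (A k)ᴴ * A k) * Z := by
    have h1 : ∀ k, (Y * A k - A k * Z)ᴴ * (Y * A k - A k * Z)
        = (A k)ᴴ * (Yᴴ * Y) * A k - ((A k)ᴴ * Yᴴ * A k) * Z - Zᴴ * ((A k)ᴴ * Y * A k)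
          + Zᴴ * ((A k)ᴴ * A k) * Z := by
      intro k
      simp only [conjTranspose_sub, conjTranspose_mul, Matrix.sub_mul, Matrix.mul_sub,
        Matrix.mul_assoc]
      abel
    have h2 : ∑ k, (A k)ᴴ * Yᴴ * A k = Zᴴ := by rw [hZ, ← krausAdj_conjTranspose]; rfl
    have h3 : ∑ k, (A k)ᴴ * Y * A k = Z := rfl
    simp only [h1, Finset.sum_add_distrib, Finset.sum_sub_distrib]
    rw [← Finset.sum_mul, ← Finset.mul_sum, ← Finset.sum_mul, ← Finset.mul_sum, h2, h3, mul_sub,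
      sub_mul, mul_one, krausAdj]
    abel
  rw [h]
  exact (posSemidef_sum _ fun k _ => posSemidef_conjTranspose_mul_self _).add
    (hA.conjTranspose_mul_mul_same Z)

variable {A : ι → Matrix (Fin m) (Fin n) ℂ} {a : Fin n → ℝ} {b : Fin m → ℝ}

/-- Pair the Schwarz inequality with `ρ = diag a`, move `T*` across the trace, and use `T ρ ≤ diag
b`. -/
lemma sum_normSq_krausAdj_le (hA : (1 - ∑ k, (A k)ᴴ * A k).PosSemidef) (ha : ∀ i, 0 < a i)
    (hab : (realDiag b - krausMap A (realDiag a)).PosSemidef) (Y : Op m) :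
    ∑ i, ∑ j, a j * Complex.normSq (krausAdj A Y i j)
      ≤ ∑ k, ∑ l, b l * Complex.normSq (Y k l) := by
  rw [← re_trace_realDiag_mul, ← re_trace_realDiag_mul]
  have hapsd : (realDiag a).PosSemidef := by
    rw [posSemidef_diagonal_iff]; exact fun i => by exact_mod_cast (ha i).le
  have h1 := PosSemidef.trace_mul_re_nonneg hapsd (posSemidef_krausAdj_sub hA Y)
  have h2 := PosSemidef.trace_mul_re_nonneg hab (posSemidef_conjTranspose_mul_self Y)
  rw [mul_sub, trace_sub, Complex.sub_re, trace_mul_comm, trace_krausAdj_mul] at h1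
  rw [sub_mul, trace_sub, Complex.sub_re, trace_mul_comm (krausMap A _)] at h2
  linarith

/-- Monotonicity in dual form: `T J_ρ T* ≤ J_{T ρ + σ}`. -/
lemma sum_weight_krausAdj_le {f : ℝ → ℝ} (hf0 : ∀ x, 0 < x → 0 < f x) (hf : OperatorMonotone f)
    (hA : (1 - ∑ k, (A k)ᴴ * A k).PosSemidef) (ha : ∀ i, 0 < a i) (hb : ∀ i, 0 < b i)
    (hab : (realDiag b - krausMap A (realDiag a)).PosSemidef) (Y : Op m) :
    ∑ i, ∑ j, a j * f (a i / a j) * Complex.normSq (krausAdj A Y i j)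
      ≤ ∑ k, ∑ l, b l * f (b k / b l) * Complex.normSq (Y k l) := by
  -- `V` is the matrix of `R_ρ^{1/2} T* R_{ρ'}^{-1/2}`.
  let V : Matrix (Fin n × Fin n) (Fin m × Fin m) ℂ := of fun p q =>
    ((√(a p.2) / √(b q.2) : ℝ) : ℂ) * ∑ s, star (A s q.1 p.1) * A s q.2 p.2
  have hsb : ∀ l, (√(b l) : ℂ) ≠ 0 := fun l => by exact_mod_cast (Real.sqrt_pos.2 (hb l)).ne'
  have hV : ∀ (Y : Op m) i j, (V *ᵥ fun q => (√(b q.2) : ℂ) * Y q.1 q.2) (i, j)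
      = (√(a j) : ℂ) * krausAdj A Y i j := by
    intro Y i j
    have h1 : krausAdj A Y i j = ∑ k, ∑ l, (∑ s, star (A s k i) * A s l j) * Y k l := by
      simp only [krausAdj, Matrix.sum_apply, mul_apply, conjTranspose_apply, Finset.sum_mul]
      rw [Finset.sum_comm]
      rw [Finset.sum_congr rfl fun k _ => Finset.sum_comm]
      rw [Finset.sum_comm]
      refine Finset.sum_congr rfl fun k _ => Finset.sum_congr rfl fun l _ =>
        Finset.sum_congr rfl fun s _ => ?_
      ring
    rw [h1, mulVec, dotProduct, Fintype.sum_prod_type, Finset.mul_sum]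
    refine Finset.sum_congr rfl fun k _ => ?_
    rw [Finset.mul_sum]
    refine Finset.sum_congr rfl fun l _ => ?_
    simp only [V, of_apply]
    push_cast
    field_simp [hsb l]
  have hnorm : ∀ (x : ℝ) (z : ℂ), 0 < x → Complex.normSq ((√x : ℂ) * z) = x * Complex.normSq z := by
    intro x z hx
    rw [Complex.normSq_mul, Complex.normSq_ofReal, Real.mul_self_sqrt hx.le]
  -- The substitution `y = R_{ρ'}^{1/2} Y` is bijective, so each operator inequality for `V` is an
  -- inequality of weighted sums for `T*`.
  have hiff : ∀ (d : Fin m × Fin m → ℝ) (e : Fin n × Fin n → ℝ),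
      (realDiag d - Vᴴ * realDiag e * V).PosSemidef ↔ ∀ Y : Op m,
        ∑ i, ∑ j, e (i, j) * (a j * Complex.normSq (krausAdj A Y i j))
          ≤ ∑ k, ∑ l, d (k, l) * (b l * Complex.normSq (Y k l)) := by
    intro d e
    rw [posSemidef_realDiag_sub_iff]
    have h2 : ∀ Y : Op m, (∑ p, e p * Complex.normSq
        ((V *ᵥ fun q => (√(b q.2) : ℂ) * Y q.1 q.2) p) ≤
        ∑ q, d q * Complex.normSq ((√(b q.2) : ℂ) * Y q.1 q.2)) ↔
        ∑ i, ∑ j, e (i, j) * (a j * Complex.normSq (krausAdj A Y i j))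
          ≤ ∑ k, ∑ l, d (k, l) * (b l * Complex.normSq (Y k l)) := by
      intro Y
      simp only [Fintype.sum_prod_type, hV, hnorm _ _ (ha _), hnorm _ _ (hb _)]
    constructor
    · intro h Y
      exact (h2 Y).1 (h _)
    · intro h y
      have := (h2 (of fun k l => (√(b l) : ℂ)⁻¹ * y (k, l))).2 (h _)
      simpa only [of_apply, mul_inv_cancel_left₀ (hsb _)] using this
  have hsch := sum_normSq_krausAdj_le hA ha hab
  have h1 : (1 - Vᴴ * V).PosSemidef := by
    have := (hiff (fun _ => 1) (fun _ => 1)).2 fun Y => by simpa only [one_mul] using hsch Y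
    rwa [realDiag_one, realDiag_one, Matrix.mul_one] at this
  have h2 : (realDiag (fun q : Fin m × Fin m => b q.1 / b q.2)
      - Vᴴ * realDiag (fun p : Fin n × Fin n => a p.1 / a p.2) * V).PosSemidef := by
    refine (hiff _ _).2 fun Y => ?_
    have h3 : ∀ (x y z : ℝ), 0 < y → x / y * (y * z) = x * z := fun x y z hy => by field_simp
    simp only [h3 _ _ _ (ha _), h3 _ _ _ (hb _)]
    -- Since `T*` commutes with the adjoint, the bound at `Yᴴ` exchanges right and left
    -- multiplication.
    have h4 := hsch Yᴴ
    rw [krausAdj_conjTranspose] at h4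
    simp only [conjTranspose_apply, Complex.star_def, Complex.normSq_conj] at h4
    rw [Finset.sum_comm, Finset.sum_comm (γ := Fin m)]
    exact h4
  have h3 := hf.posSemidef_sub_conj hf0 (fun p : Fin n × Fin n => div_pos (ha p.1) (ha p.2))
    (fun q : Fin m × Fin m => div_pos (hb q.1) (hb q.2)) h1 h2
  refine le_of_eq_of_le ?_ (((hiff _ _).1 h3 Y).trans_eq ?_) <;>
  exact Finset.sum_congr rfl fun _ _ => Finset.sum_congr rfl fun _ _ => by ring

/-- Take `Y = J_{ρ'}⁻¹ T X`. Then `⟨T* Y, X⟩` and `⟨Y, J_{ρ'} Y⟩` both equal the left side. By the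
arithmetic-geometric inequality, `2 Re ⟨T* Y, X⟩ ≤ ⟨X, J_ρ⁻¹ X⟩ + ⟨T* Y, J_ρ T* Y⟩`, and the dual
bound controls the last term. -/
lemma petzForm_krausMap_realDiag_le {f : ℝ → ℝ} (hf0 : ∀ x, 0 < x → 0 < f x)
    (hf : OperatorMonotone f)
    (hA : (1 - ∑ k, (A k)ᴴ * A k).PosSemidef) (ha : ∀ i, 0 < a i) (hb : ∀ i, 0 < b i)
    (hab : (realDiag b - krausMap A (realDiag a)).PosSemidef) (X : Op n) :
    (petzForm f (realDiag b) (krausMap A X) (krausMap A X)).re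
      ≤ (petzForm f (realDiag a) X X).re := by
  rw [petzForm_realDiag_self hf0 ha, petzForm_realDiag_self hf0 hb, Complex.ofReal_re,
    Complex.ofReal_re]
  set W : Fin n → Fin n → ℝ := fun i j => a j * f (a i / a j)
  set W' : Fin m → Fin m → ℝ := fun i j => b j * f (b i / b j)
  have hW : ∀ i j, 0 < W i j := fun i j => mul_pos (ha j) (hf0 _ (div_pos (ha i) (ha j)))
  have hW' : ∀ i j, 0 < W' i j := fun i j => mul_pos (hb j) (hf0 _ (div_pos (hb i) (hb j)))
  let Y : Op m := of fun k l => krausMap A X k l * ((W' k l)⁻¹ : ℝ)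
  have hkey : ∑ i, ∑ j, W i j * Complex.normSq (krausAdj A Y i j)
      ≤ ∑ k, ∑ l, W' k l * Complex.normSq (Y k l) := sum_weight_krausAdj_le hf0 hf hA ha hb hab Y
  have hY : ∑ k, ∑ l, W' k l * Complex.normSq (Y k l)
      = ∑ k, ∑ l, Complex.normSq (krausMap A X k l) * (W' k l)⁻¹ := by
    refine Finset.sum_congr rfl fun k _ => Finset.sum_congr rfl fun l _ => ?_
    have := (hW' k l).ne'
    simp only [Y, of_apply, Complex.normSq_mul, Complex.normSq_ofReal]
    field_simp
  have hZX : ∑ i, ∑ j, (star (krausAdj A Y i j) * X i j).re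
      = ∑ k, ∑ l, Complex.normSq (krausMap A X k l) * (W' k l)⁻¹ := by
    have h1 := trace_krausAdj_mul A Yᴴ X
    rw [krausAdj_conjTranspose, trace_conjTranspose_mul, trace_conjTranspose_mul] at h1
    have h2 := congrArg Complex.re h1
    simp only [Complex.re_sum] at h2
    rw [h2]
    refine Finset.sum_congr rfl fun k _ => Finset.sum_congr rfl fun l _ => ?_
    simp only [Y, of_apply, star_mul', Complex.star_def, Complex.conj_ofReal]
    rw [mul_right_comm, ← Complex.normSq_eq_conj_mul_self, ← Complex.ofReal_mul, Complex.ofReal_re]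
  have hpt : ∀ i j, 2 * (star (krausAdj A Y i j) * X i j).re ≤
      Complex.normSq (X i j) * (W i j)⁻¹ + W i j * Complex.normSq (krausAdj A Y i j) := by
    intro i j
    have hw := hW i j
    have h0 := mul_nonneg (Complex.normSq_nonneg (X i j - (W i j : ℂ) * krausAdj A Y i j))
      (inv_nonneg.2 hw.le)
    have h1 : Complex.normSq (X i j - (W i j : ℂ) * krausAdj A Y i j) * (W i j)⁻¹
        = Complex.normSq (X i j) * (W i j)⁻¹ + W i j * Complex.normSq (krausAdj A Y i j)
          - 2 * (star (krausAdj A Y i j) * X i j).re := by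
      simp only [Complex.normSq_apply, Complex.sub_re, Complex.sub_im, Complex.mul_re,
        Complex.mul_im, Complex.ofReal_re, Complex.ofReal_im, Complex.star_def, Complex.conj_re,
        Complex.conj_im]
      field_simp
      ring
    linarith
  have hsum := Finset.sum_le_sum fun i (_ : i ∈ Finset.univ) =>
    Finset.sum_le_sum fun j (_ : j ∈ Finset.univ) => hpt i j
  simp only [← Finset.mul_sum, Finset.sum_add_distrib] at hsum
  linarith

lemma petzForm_add_le {f : ℝ → ℝ} (hf0 : ∀ x, 0 < x → 0 < f x) (hf : OperatorMonotone f)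
    {T : Op n →ₗ[ℂ] Op m} (hT : IsCPTNI T) {ρ : Op n} (hρ : ρ.PosDef) {σ : Op m}
    (hσ : σ.PosSemidef) (hρσ : (T ρ + σ).PosDef) (X : Op n) :
    (petzForm f (T ρ + σ) (T X) (T X)).re ≤ (petzForm f ρ X X).re := by
  obtain ⟨A, hA, rfl⟩ := hT.exists_eq_krausMap
  obtain ⟨U, a, hU, ha, rfl⟩ := PosDef.exists_eq_conj_realDiag hρ
  obtain ⟨U', b, hU', hb, hb'⟩ := PosDef.exists_eq_conj_realDiag hρσ
  have h1 : U * Uᴴ = 1 := mul_eq_one_comm.1 hU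
  have h1' : U' * U'ᴴ = 1 := mul_eq_one_comm.1 hU'
  rw [hb', petzForm_conj hf0 hU' hb, petzForm_conj hf0 hU ha]
  -- The Kraus operators are read in the eigenbases of `ρ` and of `T ρ + σ`, so that both base
  -- points become diagonal.
  let B : Fin n × Fin m → Matrix (Fin m) (Fin n) ℂ := fun k => U'ᴴ * A k * U
  have hB : ∀ X, U'ᴴ * krausMap A X * U' = krausMap B (Uᴴ * X * U) := by
    intro X
    rw [krausMap_apply, krausMap_apply, Finset.mul_sum, Finset.sum_mul]
    refine Finset.sum_congr rfl fun k _ => ?_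
    calc U'ᴴ * (A k * X * (A k)ᴴ) * U' = U'ᴴ * (A k * (1 * X * 1) * (A k)ᴴ) * U' := by simp
      _ = _ := by
        rw [← h1]
        simp only [B, conjTranspose_mul, conjTranspose_conjTranspose, Matrix.mul_assoc]
  rw [hB]
  refine petzForm_krausMap_realDiag_le hf0 hf ?_ ha hb ?_ _
  · have : 1 - ∑ k, (B k)ᴴ * B k = Uᴴ * (1 - ∑ k, (A k)ᴴ * A k) * U := by
      rw [mul_sub, sub_mul, mul_one, hU, Finset.mul_sum, Finset.sum_mul]
      congr 1
      refine Finset.sum_congr rfl fun k _ => ?_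
      calc (B k)ᴴ * B k = Uᴴ * ((A k)ᴴ * (U' * U'ᴴ) * A k) * U := by
            simp only [B, conjTranspose_mul, conjTranspose_conjTranspose, Matrix.mul_assoc]
        _ = _ := by rw [h1', Matrix.mul_one]
    rw [this]
    exact hA.conjTranspose_mul_mul_same U
  · have h2 : realDiag b = U'ᴴ * (krausMap A (U * realDiag a * Uᴴ) + σ) * U' := by
      rw [hb', conj_mul_conj_cancel hU']
    rw [h2, mul_add, add_mul, hB, conj_mul_conj_cancel hU, add_sub_cancel_left]
    exact hσ.conjTranspose_mul_mul_same U'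

lemma exists_core_petzForm {f : ℝ → ℝ} (hf0 : ∀ x, 0 < x → 0 < f x) {ρ : Op n} (hρ : ρ.PosDef) :
    ∃ c : InnerProductSpace.Core ℂ (Op n), ∀ X Y : Op n, c.inner X Y = petzForm f ρ X Y := by
  obtain ⟨U, a, hU, ha, rfl⟩ := PosDef.exists_eq_conj_realDiag hρ
  have hw : ∀ i j, 0 < (a j * f (a i / a j))⁻¹ := fun i j =>
    inv_pos.2 (mul_pos (ha j) (hf0 _ (div_pos (ha i) (ha j))))
  have hself : ∀ X, petzForm f (U * realDiag a * Uᴴ) X X = ((∑ i, ∑ j,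
      Complex.normSq ((Uᴴ * X * U) i j) * (a j * f (a i / a j))⁻¹ : ℝ) : ℂ) := fun X => by
    rw [petzForm_conj hf0 hU ha, petzForm_realDiag_self hf0 ha]
  have hform := petzForm_eq_sum hf0 hU ha rfl
  refine ⟨
    { inner := petzForm f (U * realDiag a * Uᴴ)
      conj_inner_symm := ?_
      re_inner_nonneg := ?_
      add_left := ?_
      smul_left := ?_
      definite := ?_ }, fun _ _ => rfl⟩
  · intro X Y
    simp only [hform, map_sum, map_mul, Complex.star_def, Complex.conj_conj, Complex.conj_ofReal]
    exact Finset.sum_congr rfl fun _ _ => Finset.sum_congr rfl fun _ _ => by ring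
  · intro X
    rw [hself, RCLike.re_to_complex, Complex.ofReal_re]
    exact Finset.sum_nonneg fun i _ => Finset.sum_nonneg fun j _ =>
      mul_nonneg (Complex.normSq_nonneg _) (hw i j).le
  · intro X Y Z
    simp only [hform, ← Finset.sum_add_distrib, mul_add, add_mul, Matrix.add_apply, star_add]
  · intro X Y r
    simp only [hform, Finset.mul_sum, mul_smul_comm, smul_mul_assoc, Matrix.smul_apply,
      smul_eq_mul, star_mul', Complex.star_def]
    exact Finset.sum_congr rfl fun _ _ => Finset.sum_congr rfl fun _ _ => by ring
  · intro X hX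
    rw [hself] at hX
    have h0 := (Finset.sum_eq_zero_iff_of_nonneg fun i _ => Finset.sum_nonneg fun j _ =>
      mul_nonneg (Complex.normSq_nonneg ((Uᴴ * X * U) i j)) (hw i j).le).1 (by exact_mod_cast hX)
    have h1 : Uᴴ * X * U = 0 := by
      ext i j
      have h2 := (Finset.sum_eq_zero_iff_of_nonneg fun j _ =>
        mul_nonneg (Complex.normSq_nonneg ((Uᴴ * X * U) i j)) (hw i j).le).1
        (h0 i (Finset.mem_univ i)) j (Finset.mem_univ j)
      exact Complex.normSq_eq_zero.1 ((mul_eq_zero.1 h2).resolve_right (hw i j).ne')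
    have hUU : U * Uᴴ = 1 := mul_eq_one_comm.1 hU
    calc X = (U * Uᴴ) * X * (U * Uᴴ) := by rw [hUU, one_mul, mul_one]
      _ = U * (Uᴴ * X * U) * Uᴴ := by simp only [mul_assoc]
      _ = 0 := by rw [h1]; simp

end Sufficiency

/-! ### Elementary geometry of complex inner products. -/

section InnerForm

lemma complex_eq_of_re_mul_eq {z w : ℂ} (h : ∀ r : ℂ, (r * z).re = (r * w).re) : z = w := by
  refine Complex.ext ?_ ?_
  · simpa using h 1
  · simpa using h Complex.I

variable {V : Type*} [AddCommGroup V] [Module ℂ V]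

/-- `B` is a complex inner product, conjugate-linear in the first variable. -/
def IsInnerForm (B : V → V → ℂ) : Prop :=
  ∃ c : InnerProductSpace.Core ℂ V, ∀ x y : V, c.inner x y = B x y

namespace IsInnerForm

variable {B B' : V → V → ℂ}

lemma conj_symm (hB : IsInnerForm B) (x y : V) : starRingEnd ℂ (B y x) = B x y := by
  obtain ⟨c, hc⟩ := hB
  rw [← hc, ← hc]; exact c.conj_inner_symm x y

lemma add_left (hB : IsInnerForm B) (x y z : V) : B (x + y) z = B x z + B y z := by
  obtain ⟨c, hc⟩ := hB
  rw [← hc, ← hc, ← hc]; exact c.add_left x y z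

lemma smul_left (hB : IsInnerForm B) (r : ℂ) (x y : V) : B (r • x) y = starRingEnd ℂ r * B x y := by
  obtain ⟨c, hc⟩ := hB
  rw [← hc, ← hc]; exact c.smul_left x y r

lemma re_nonneg (hB : IsInnerForm B) (x : V) : 0 ≤ (B x x).re := by
  obtain ⟨c, hc⟩ := hB
  rw [← hc]; exact c.re_inner_nonneg x

lemma self_eq_re (hB : IsInnerForm B) (x : V) : B x x = ((B x x).re : ℂ) :=
  (Complex.conj_eq_iff_re.1 (hB.conj_symm x x)).symm

lemma re_pos (hB : IsInnerForm B) {x : V} (hx : x ≠ 0) : 0 < (B x x).re := by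
  refine (hB.re_nonneg x).lt_of_ne' fun h => hx ?_
  have h0 : B x x = 0 := by rw [hB.self_eq_re, h, Complex.ofReal_zero]
  obtain ⟨c, hc⟩ := hB
  exact c.definite x ((hc x x).trans h0)

lemma add_right (hB : IsInnerForm B) (x y z : V) : B x (y + z) = B x y + B x z := by
  rw [← hB.conj_symm, hB.add_left, map_add, hB.conj_symm, hB.conj_symm]

lemma smul_right (hB : IsInnerForm B) (r : ℂ) (x y : V) : B x (r • y) = r * B x y := by
  rw [← hB.conj_symm, hB.smul_left, map_mul, hB.conj_symm, Complex.conj_conj]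

lemma re_smul (hB : IsInnerForm B) (r : ℂ) (x : V) :
    (B (r • x) (r • x)).re = Complex.normSq r * (B x x).re := by
  rw [hB.smul_left, hB.smul_right, ← mul_assoc, ← Complex.normSq_eq_conj_mul_self,
    Complex.re_ofReal_mul]

lemma re_add (hB : IsInnerForm B) (x y : V) :
    (B (x + y) (x + y)).re = (B x x).re + 2 * (B x y).re + (B y y).re := by
  rw [hB.add_left, hB.add_right, hB.add_right, ← hB.conj_symm y x]
  simp only [Complex.add_re, Complex.conj_re]
  ring

lemma re_add_smul (hB : IsInnerForm B) (x y : V) (r : ℂ) : (B (x + r • y) (x + r • y)).re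
    = (B x x).re + 2 * (r * B x y).re + Complex.normSq r * (B y y).re := by
  rw [hB.re_add, hB.re_smul, hB.smul_right]

lemma eq_zero_of_re_le (hB : IsInnerForm B) {x y : V}
    (h : ∀ r : ℂ, (B x x).re ≤ (B (x + r • y) (x + r • y)).re) :
    B x y = 0 := by
  have hy := hB.re_nonneg y
  have hpos : 0 < 1 + (B y y).re := by linarith
  -- Nearly the minimiser in `r`; the `1 +` in the denominator avoids a separate case `y = 0`.
  have h1 := h (-((1 + (B y y).re)⁻¹ : ℝ) * starRingEnd ℂ (B x y))
  have h2 : (-((1 + (B y y).re)⁻¹ : ℝ) * starRingEnd ℂ (B x y) * B x y).re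
      = -(1 + (B y y).re)⁻¹ * Complex.normSq (B x y) := by
    rw [mul_assoc, ← Complex.normSq_eq_conj_mul_self, ← Complex.ofReal_neg, ← Complex.ofReal_mul,
      Complex.ofReal_re]
  rw [hB.re_add_smul, h2, Complex.normSq_mul, Complex.normSq_conj, Complex.normSq_neg,
    Complex.normSq_ofReal] at h1
  refine Complex.normSq_eq_zero.1 (le_antisymm ?_ (Complex.normSq_nonneg _))
  set q := (B y y).re
  set N := Complex.normSq (B x y)
  by_contra hN
  have hN : 0 < N := not_le.1 hN
  have hi : (1 + q)⁻¹ * (1 + q) = 1 := inv_mul_cancel₀ hpos.ne'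
  have hi0 : 0 < (1 + q)⁻¹ := inv_pos.2 hpos
  have h3 : 0 ≤ (1 + q)⁻¹ * N * (-2 + (1 + q)⁻¹ * q) := by linarith
  have h4 : (1 + q)⁻¹ * q < 2 := by linarith
  have h5 : 0 < (1 + q)⁻¹ * N * (2 - (1 + q)⁻¹ * q) := by
    have := sub_pos.2 h4
    positivity
  linarith

/-- Polarization. -/
lemma ext_re (hB : IsInnerForm B) (hB' : IsInnerForm B')
    (h : ∀ x, (B x x).re = (B' x x).re) (x y : V) : B x y = B' x y := by
  refine complex_eq_of_re_mul_eq fun r => ?_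
  have h1 := h (x + r • y)
  rw [hB.re_add_smul, hB'.re_add_smul, h x, h y] at h1
  linarith

/-- Vectors on which an isometry acts by distinct phases are orthogonal. -/
lemma eq_zero_of_phase (hB : IsInnerForm B) {x y : V} {u v : ℂ}
    (hu : Complex.normSq u = 1) (hv : Complex.normSq v = 1)
    (huv : u ≠ v)
    (h : ∀ r : ℂ, (B (u • x + r • v • y) (u • x + r • v • y)).re
      = (B (x + r • y) (x + r • y)).re) : B x y = 0 := by
  have h1 : starRingEnd ℂ u * v * B x y = B x y := by
    refine complex_eq_of_re_mul_eq fun r => ?_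
    have h2 := h r
    rw [hB.re_add_smul, hB.re_add_smul, hB.re_smul, hB.re_smul, hB.smul_left, hB.smul_right, hu,
      hv, ← mul_assoc (starRingEnd ℂ u)] at h2
    linarith
  by_contra h0
  have h2 : starRingEnd ℂ u * v = 1 := mul_right_cancel₀ h0 (h1.trans (one_mul _).symm)
  apply huv
  calc u = u * (starRingEnd ℂ u * v) := by rw [h2, mul_one]
    _ = v := by rw [← mul_assoc, Complex.mul_conj, hu, Complex.ofReal_one, one_mul]

lemma zero_left (hB : IsInnerForm B) (y : V) : B 0 y = 0 := by
  simpa using hB.smul_left 0 0 y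

lemma zero_right (hB : IsInnerForm B) (x : V) : B x 0 = 0 := by
  simpa using hB.smul_right 0 x 0

lemma sum_right (hB : IsInnerForm B) {ι : Type*} (s : Finset ι) (x : V) (y : ι → V) :
    B x (∑ i ∈ s, y i) = ∑ i ∈ s, B x (y i) :=
  map_sum (AddMonoidHom.mk (ZeroHom.mk (B x) (hB.zero_right x)) (hB.add_right x)) y s

/-- Pythagoras for a finite orthogonal family. -/
lemma re_sum (hB : IsInnerForm B) {ι : Type*} [DecidableEq ι] (s : Finset ι) {x : ι → V}
    (h : ∀ i j, i ≠ j → B (x i) (x j) = 0) :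
    (B (∑ i ∈ s, x i) (∑ i ∈ s, x i)).re = ∑ i ∈ s, (B (x i) (x i)).re := by
  induction s using Finset.induction_on with
  | empty => simp [hB.zero_left]
  | insert a s ha ih =>
    rw [Finset.sum_insert ha, Finset.sum_insert ha, hB.re_add, ih, hB.sum_right,
      Finset.sum_eq_zero fun i hi => h a i fun hai => ha (hai ▸ hi)]
    simp

end IsInnerForm

end InnerForm

/-! ### Coordinate embeddings. -/

section Embedding

variable {n k : ℕ}

/-- The isometry `eⱼ ↦ e_{φ j}` of coordinate spaces. -/
def coordEmbed (φ : Fin k → Fin n) : Matrix (Fin n) (Fin k) ℂ :=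
  of fun i j => if i = φ j then 1 else 0

lemma conjTranspose_coordEmbed_mulVec (φ : Fin k → Fin n) (y : Fin n → ℂ) (j : Fin k) :
    ((coordEmbed φ)ᴴ *ᵥ y) j = y (φ j) := by
  simp [mulVec, dotProduct, coordEmbed, conjTranspose_apply, apply_ite star]

lemma conjTranspose_coordEmbed_mul_mul (φ : Fin k → Fin n) (X : Op n) :
    (coordEmbed φ)ᴴ * X * coordEmbed φ = X.submatrix φ φ := by
  ext i j
  simp [mul_apply, coordEmbed, conjTranspose_apply, apply_ite star]

lemma conjTranspose_coordEmbed_mul_self {φ : Fin k → Fin n} (hφ : Function.Injective φ) :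
    (coordEmbed φ)ᴴ * coordEmbed φ = 1 := by
  have h := conjTranspose_coordEmbed_mul_mul φ 1
  rwa [Matrix.mul_one, submatrix_one _ hφ] at h

lemma coordEmbed_mul_single_mul (φ : Fin k → Fin n) (i j : Fin k) (x : ℂ) :
    coordEmbed φ * single i j x * (coordEmbed φ)ᴴ = single (φ i) (φ j) x := by
  ext a b
  rw [mul_apply, Finset.sum_eq_single j]
  · by_cases ha : a = φ i <;> by_cases hb : b = φ j <;>
      simp [mul_apply, coordEmbed, conjTranspose_apply, single_apply, ha, hb, eq_comm]
  · intro c _ hc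
    simp [mul_apply, hc.symm]
  · simp

lemma posSemidef_realDiag_sub_coordEmbed {φ : Fin k → Fin n} (hφ : Function.Injective φ)
    {a : Fin n → ℝ} (ha : ∀ i, 0 ≤ a i) :
    (realDiag a - coordEmbed φ * realDiag (a ∘ φ) * (coordEmbed φ)ᴴ).PosSemidef := by
  have h := (posSemidef_realDiag_sub_iff (V := (coordEmbed φ)ᴴ) (d := a) (e := a ∘ φ)).2 fun y => by
    simp only [conjTranspose_coordEmbed_mulVec, Function.comp_apply]
    rw [← Finset.sum_image (s := Finset.univ) (g := φ)
      (f := fun i => a i * Complex.normSq (y i)) hφ.injOn]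
    exact Finset.sum_le_univ_sum_of_nonneg fun i => mul_nonneg (ha i) (Complex.normSq_nonneg _)
  rwa [conjTranspose_conjTranspose] at h

end Embedding

/-! ### Invariance of a monotone metric and orthogonality of the matrix units. -/

section Necessity

variable {K : (n : ℕ) → Op n → Op n → Op n → ℂ} {n m : ℕ}

lemma IsMonotoneMetric.isInnerForm (hK : IsMonotoneMetric K) (hn : 0 < n) {ρ : Op n}
    (hρ : ρ ∈ StrictSubState n) : IsInnerForm (K n ρ) :=
  hK.inner n hn ρ hρ

/-- The axiom is used with `σ = ρ' - T ρ`, whose trace is at most that of `ρ'` because `T ρ` is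
positive semidefinite. -/
lemma IsMonotoneMetric.krausMap_le (hK : IsMonotoneMetric K) (hn : 0 < n) (hm : 0 < m) {ι : Type*}
    [Fintype ι] {A : ι → Matrix (Fin m) (Fin n) ℂ} (hA : (1 - ∑ k, (A k)ᴴ * A k).PosSemidef)
    {ρ : Op n} (hρ : ρ ∈ StrictSubState n) {ρ' : Op m} (hρ' : ρ' ∈ StrictSubState m)
    (h : (ρ' - krausMap A ρ).PosSemidef) (X : Op n) :
    (K m ρ' (krausMap A X) (krausMap A X)).re ≤ (K n ρ X X).re := by
  have hpsd : (krausMap A ρ).PosSemidef :=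
    posSemidef_sum _ fun k _ => hρ.1.posSemidef.mul_mul_conjTranspose_same (A k)
  have htr : 0 ≤ (krausMap A ρ).trace.re := (Complex.le_def.1 hpsd.trace_nonneg).1
  have h1 : (ρ' - krausMap A ρ).trace.re ≤ 1 := by
    rw [trace_sub, Complex.sub_re]
    have := hρ'.2
    linarith
  have h2 := hK.monotone n m hn hm _ (isCPTNI_krausMap hA) X ρ hρ (ρ' - krausMap A ρ) ⟨h, h1⟩
  rw [add_sub_cancel] at h2
  exact h2 hρ'

lemma IsMonotoneMetric.conj_le (hK : IsMonotoneMetric K) (hn : 0 < n) (hm : 0 < m)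
    {A : Matrix (Fin m) (Fin n) ℂ} (hA : (1 - Aᴴ * A).PosSemidef)
    {ρ : Op n} (hρ : ρ ∈ StrictSubState n) {ρ' : Op m} (hρ' : ρ' ∈ StrictSubState m)
    (h : (ρ' - A * ρ * Aᴴ).PosSemidef) (X : Op n) :
    (K m ρ' (A * X * Aᴴ) (A * X * Aᴴ)).re ≤ (K n ρ X X).re := by
  have h1 : ∀ X, krausMap (fun _ : Unit => A) X = A * X * Aᴴ := fun X => by simp [krausMap_apply]
  have := hK.krausMap_le hn hm (A := fun _ : Unit => A) (by simpa using hA) hρ hρ' (by rwa [h1]) X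
  rwa [h1] at this

lemma conj_mem_strictSubState {U : Op n} (hU : Uᴴ * U = 1) {ρ : Op n} (hρ : ρ ∈ StrictSubState n) :
    U * ρ * Uᴴ ∈ StrictSubState n := by
  refine ⟨(posDef_conj_iff hU).2 hρ.1, ?_⟩
  rw [trace_mul_comm, ← mul_assoc, hU, one_mul]
  exact hρ.2

lemma realDiag_mem_strictSubState_iff {a : Fin n → ℝ} :
    realDiag a ∈ StrictSubState n ↔ (∀ i, 0 < a i) ∧ ∑ i, a i ≤ 1 := by
  rw [StrictSubState, Set.mem_ofPred_eq, posDef_diagonal_iff, trace_diagonal, Complex.re_sum]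
  simp only [Complex.ofReal_re, Complex.zero_lt_real]

lemma IsMonotoneMetric.unitary_conj (hK : IsMonotoneMetric K) (hn : 0 < n) {U : Op n}
    (hU : Uᴴ * U = 1) {ρ : Op n} (hρ : ρ ∈ StrictSubState n) (X : Op n) :
    (K n (U * ρ * Uᴴ) (U * X * Uᴴ) (U * X * Uᴴ)).re = (K n ρ X X).re := by
  have hU' : U * Uᴴ = 1 := mul_eq_one_comm.1 hU
  refine le_antisymm ?_ ?_
  · refine hK.conj_le hn hn ?_ hρ (conj_mem_strictSubState hU hρ) ?_ X
    · rw [hU, sub_self]; exact .zero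
    · rw [sub_self]; exact .zero
  · have := hK.conj_le hn hn (A := Uᴴ) (ρ' := ρ) ?_ (conj_mem_strictSubState hU hρ) hρ ?_
      (U * X * Uᴴ)
    · rwa [conjTranspose_conjTranspose, conj_mul_conj_cancel hU] at this
    · rw [conjTranspose_conjTranspose, hU', sub_self]; exact .zero
    · rw [conjTranspose_conjTranspose, conj_mul_conj_cancel hU, sub_self]; exact .zero

lemma realDiag_comp_mem_strictSubState {k : ℕ} {φ : Fin k → Fin n} (hφ : Function.Injective φ) {a : Fin n → ℝ}
    (ha : realDiag a ∈ StrictSubState n) : realDiag (a ∘ φ) ∈ StrictSubState k := by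
  rw [realDiag_mem_strictSubState_iff] at ha ⊢
  refine ⟨fun i => ha.1 _, le_trans ?_ ha.2⟩
  simp only [Function.comp_apply]
  rw [← Finset.sum_image (s := Finset.univ) (g := φ) (f := a) hφ.injOn]
  exact Finset.sum_le_univ_sum_of_nonneg fun i => (ha.1 i).le

/-- Embedding followed by compression is the identity, and both are CPTNI. The embedded state lacks
some diagonal entries of `diag a`, which `σ` supplies; the compression loses trace. This is where
trace-non-increasing maps say more than trace-preserving ones. -/
lemma IsMonotoneMetric.coordEmbed_conj (hK : IsMonotoneMetric K) {k : ℕ} (hn : 0 < n) (hk : 0 < k)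
    {φ : Fin k → Fin n} (hφ : Function.Injective φ) {a : Fin n → ℝ}
    (ha : realDiag a ∈ StrictSubState n) (X : Op k) :
    (K n (realDiag a) (coordEmbed φ * X * (coordEmbed φ)ᴴ)
      (coordEmbed φ * X * (coordEmbed φ)ᴴ)).re = (K k (realDiag (a ∘ φ)) X X).re := by
  have hk' := realDiag_comp_mem_strictSubState hφ ha
  have hpos := (realDiag_mem_strictSubState_iff.1 ha).1
  refine le_antisymm ?_ ?_
  · refine hK.conj_le hk hn ?_ hk' ha ?_ X
    · rw [conjTranspose_coordEmbed_mul_self hφ, sub_self]; exact .zero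
    · exact posSemidef_realDiag_sub_coordEmbed hφ fun i => (hpos i).le
  · have := hK.conj_le hn hk (A := (coordEmbed φ)ᴴ) (ρ' := realDiag (a ∘ φ)) ?_ ha hk' ?_
      (coordEmbed φ * X * (coordEmbed φ)ᴴ)
    · have h1 : (coordEmbed φ)ᴴ * (coordEmbed φ * X * (coordEmbed φ)ᴴ) * coordEmbed φ = X := by
        rw [Matrix.mul_assoc, Matrix.mul_assoc, conjTranspose_coordEmbed_mul_self hφ,
          Matrix.mul_one, ← Matrix.mul_assoc, conjTranspose_coordEmbed_mul_self hφ, Matrix.one_mul]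
      rwa [conjTranspose_conjTranspose, h1] at this
    · have := posSemidef_realDiag_sub_coordEmbed hφ (a := fun _ => 1) fun _ => zero_le_one
      rw [conjTranspose_conjTranspose]
      have h1 : ((fun _ => 1 : Fin n → ℝ) ∘ φ) = fun _ => 1 := rfl
      rwa [h1, realDiag_one, realDiag_one, Matrix.mul_one] at this
    · rw [conjTranspose_conjTranspose, conjTranspose_coordEmbed_mul_mul, submatrix_diagonal _ _ hφ]
      have : (realDiag (a ∘ φ)) - diagonal ((fun i => (a i : ℂ)) ∘ φ) = 0 := sub_self _
      rw [this]; exact .zero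

lemma realDiag_mul_single_mul_realDiag (c : Fin n → ℝ) (i j : Fin n) (x : ℂ) :
    realDiag c * single i j x * realDiag c = ((c i * c j : ℝ) : ℂ) • single i j x := by
  rw [realDiag_mul_single, smul_mul_assoc, single_mul_realDiag, smul_smul, Complex.ofReal_mul]

/-- Diagonal phases fix all `eᵢᵢ` and cannot separate them. Compression to the coordinate `i` does:
it keeps `eᵢᵢ`, kills `eₖₖ` and lowers `ρ`, so adding multiples of `eₖₖ` never shortens `eᵢᵢ`. -/
lemma IsMonotoneMetric.single_diag_orthogonal (hK : IsMonotoneMetric K) (hn : 0 < n)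
    {a : Fin n → ℝ} (ha : realDiag a ∈ StrictSubState n) {i k : Fin n} (hik : i ≠ k) (x y : ℂ) :
    K n (realDiag a) (single i i x) (single k k y) = 0 := by
  refine (hK.isInnerForm hn ha).eq_zero_of_re_le fun r => ?_
  let c : Fin n → ℝ := fun j => if j = i then 1 else 0
  have hc0 : ∀ j, c j * c j ≤ 1 := fun j => by simp only [c]; split_ifs <;> norm_num
  have hcH : (realDiag c)ᴴ = realDiag c := (isHermitian_realDiag c).eq
  have h := hK.conj_le hn hn (A := realDiag c) (ρ' := realDiag a) ?_ ha ha ?_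
    (single i i x + r • single k k y)
  · rw [hcH, mul_add, add_mul, mul_smul_comm, smul_mul_assoc, realDiag_mul_single_mul_realDiag,
      realDiag_mul_single_mul_realDiag] at h
    simpa [c, hik.symm] using h
  · rw [hcH, diagonal_mul_diagonal, ← realDiag_one, diagonal_sub, posSemidef_diagonal_iff]
    intro j
    rw [← Complex.ofReal_mul, ← Complex.ofReal_sub, Complex.zero_le_real]
    linarith [hc0 j]
  · rw [hcH, diagonal_mul_diagonal, diagonal_mul_diagonal, diagonal_sub, posSemidef_diagonal_iff]
    intro j
    rw [← Complex.ofReal_mul, ← Complex.ofReal_mul, ← Complex.ofReal_sub, Complex.zero_le_real]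
    nlinarith [hc0 j, (realDiag_mem_strictSubState_iff.1 ha).1 j]

lemma IsMonotoneMetric.single_orthogonal_of_phase (hK : IsMonotoneMetric K) (hn : 0 < n)
    {a : Fin n → ℝ} (ha : realDiag a ∈ StrictSubState n) {d : Fin n → ℂ}
    (hd : ∀ i, Complex.normSq (d i) = 1) {i j k l : Fin n}
    (h : d i * starRingEnd ℂ (d j) ≠ d k * starRingEnd ℂ (d l)) (x y : ℂ) :
    K n (realDiag a) (single i j x) (single k l y) = 0 := by
  have hd' : ∀ i, d i * starRingEnd ℂ (d i) = 1 := fun i => by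
    rw [Complex.mul_conj, hd, Complex.ofReal_one]
  have hU : (diagonal d)ᴴ * diagonal d = 1 := by
    rw [diagonal_conjTranspose, diagonal_mul_diagonal, ← diagonal_one]
    congr 1; funext i; rw [mul_comm]; exact hd' i
  have hconj : ∀ i j x, diagonal d * single i j x * (diagonal d)ᴴ
      = (d i * starRingEnd ℂ (d j)) • single i j x := by
    intro i j x
    ext a b
    rw [diagonal_conjTranspose, mul_diagonal, diagonal_mul, Matrix.smul_apply, smul_eq_mul]
    by_cases hab : i = a ∧ j = b
    · obtain ⟨rfl, rfl⟩ := hab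
      simp only [single_apply_same, Pi.star_apply, Complex.star_def]; ring
    · simp [single_apply_of_ne _ _ _ _ _ hab]
  have hfix : diagonal d * realDiag a * (diagonal d)ᴴ = realDiag a := by
    rw [diagonal_conjTranspose, diagonal_mul_diagonal, diagonal_mul_diagonal]
    congr 1; funext i
    rw [Pi.star_apply, Complex.star_def, mul_right_comm, hd', one_mul]
  refine (hK.isInnerForm hn ha).eq_zero_of_phase (u := d i * starRingEnd ℂ (d j))
    (v := d k * starRingEnd ℂ (d l)) ?_ ?_ h fun r => ?_
  · rw [Complex.normSq_mul, Complex.normSq_conj, hd, hd, one_mul]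
  · rw [Complex.normSq_mul, Complex.normSq_conj, hd, hd, one_mul]
  · have := hK.unitary_conj hn hU ha (single i j x + r • single k l y)
    rwa [hfix, mul_add, add_mul, mul_smul_comm, smul_mul_assoc, hconj, hconj] at this

lemma IsMonotoneMetric.single_orthogonal_of_ne (hK : IsMonotoneMetric K) (hn : 0 < n)
    {a : Fin n → ℝ} (ha : realDiag a ∈ StrictSubState n) {i j k l : Fin n} (hij : i ≠ j)
    (h : (i, j) ≠ (k, l)) (x y : ℂ) :
    K n (realDiag a) (single i j x) (single k l y) = 0 := by
  have hd : ∀ p q : Fin n, Complex.normSq (if q = p then Complex.I else 1) = 1 := fun p q => by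
    split_ifs <;> simp
  have hI : Complex.I ≠ -Complex.I := fun h => by
    have := congrArg Complex.im h
    norm_num at this
  have hI1 : Complex.I ≠ 1 := fun h => by simpa using congrArg Complex.im h
  have hI2 : -Complex.I ≠ 1 := fun h => by simpa using congrArg Complex.im h
  -- The phase `I` placed at coordinate `i` gives `eᵢⱼ` the factor `I`, which only other units in
  -- row `i` and off the diagonal share. For those the phase goes to coordinate `j`. A sign in place
  -- of `I` would not separate `eᵢⱼ` from `eⱼᵢ`.
  by_cases hkl : k = i ∧ l ≠ i
  · obtain ⟨rfl, hl⟩ := hkl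
    have hlj : l ≠ j := fun hlj => h (by rw [hlj])
    refine hK.single_orthogonal_of_phase hn ha (d := fun q => if q = j then Complex.I else 1)
      (hd j) ?_ x y
    simp [hij, hlj, hI2]
  · refine hK.single_orthogonal_of_phase hn ha (d := fun q => if q = i then Complex.I else 1)
      (hd i) ?_ x y
    by_cases hk : k = i <;> by_cases hl : l = i
    · simp [hk, hl, hij.symm, hI1]
    · exact absurd ⟨hk, hl⟩ hkl
    · simp [hk, hl, hij.symm, hI]
    · simp [hk, hl, hij.symm, hI1]

lemma IsMonotoneMetric.single_orthogonal (hK : IsMonotoneMetric K) (hn : 0 < n)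
    {a : Fin n → ℝ} (ha : realDiag a ∈ StrictSubState n) {i j k l : Fin n}
    (h : (i, j) ≠ (k, l)) (x y : ℂ) :
    K n (realDiag a) (single i j x) (single k l y) = 0 := by
  by_cases hij : i = j
  · by_cases hkl : k = l
    · subst hij hkl
      exact hK.single_diag_orthogonal hn ha (fun hik => h (by rw [hik])) x y
    · rw [← (hK.isInnerForm hn ha).conj_symm, hK.single_orthogonal_of_ne hn ha hkl h.symm, map_zero]
  · exact hK.single_orthogonal_of_ne hn ha hij h x y

lemma IsMonotoneMetric.re_eq_sum (hK : IsMonotoneMetric K) (hn : 0 < n)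
    {a : Fin n → ℝ} (ha : realDiag a ∈ StrictSubState n) (X : Op n) :
    (K n (realDiag a) X X).re = ∑ i, ∑ j, Complex.normSq (X i j) *
      (K n (realDiag a) (single i j 1) (single i j 1)).re := by
  have hX : X = ∑ p : Fin n × Fin n, X p.1 p.2 • single p.1 p.2 1 := by
    rw [Fintype.sum_prod_type]
    conv_lhs => rw [matrix_eq_sum_single X]
    simp
  have hB := hK.isInnerForm hn ha
  conv_lhs => rw [hX]
  rw [hB.re_sum]
  · rw [Fintype.sum_prod_type]
    simp only [hB.re_smul]
  · intro p q hpq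
    rw [hB.smul_left, hB.smul_right, hK.single_orthogonal hn ha hpq]
    simp

end Necessity

/-! ### Homogeneity in the base point. -/

section Scaling

/-- A nonnegative function that is additive on `(0, 1]` is linear there. -/
lemma eq_mul_of_additive_of_nonneg {u : ℝ → ℝ} (h0 : ∀ t, 0 < t → t ≤ 1 → 0 ≤ u t)
    (hadd : ∀ s t, 0 < s → 0 < t → s + t ≤ 1 → u (s + t) = u s + u t) {t : ℝ} (ht : 0 < t)
    (ht1 : t ≤ 1) : u t = t * u 1 := by
  have hmono : ∀ s t, 0 < s → s ≤ t → t ≤ 1 → u s ≤ u t := by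
    intro s t hs hst ht
    rcases hst.eq_or_lt with rfl | hst
    · rfl
    · have := hadd s (t - s) hs (sub_pos.2 hst) (by linarith)
      rw [add_sub_cancel] at this
      linarith [h0 (t - s) (sub_pos.2 hst) (by linarith)]
  have hmul : ∀ (k : ℕ) (s : ℝ), 0 < s → ((k + 1 : ℕ) : ℝ) * s ≤ 1 →
      u (((k + 1 : ℕ) : ℝ) * s) = ((k + 1 : ℕ) : ℝ) * u s := by
    intro k s hs
    induction k with
    | zero => intro _; simp
    | succ k ih =>
      intro hk
      have h1 : ((k + 1 + 1 : ℕ) : ℝ) * s = ((k + 1 : ℕ) : ℝ) * s + s := by push_cast; ring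
      have h2 : 0 < ((k + 1 : ℕ) : ℝ) * s := by positivity
      rw [h1] at hk ⊢
      rw [hadd _ _ h2 hs hk, ih (by linarith)]
      push_cast; ring
  have hrat : ∀ k N : ℕ, 0 < k → k ≤ N → u ((k : ℝ) / N) = (k : ℝ) / N * u 1 := by
    intro k N hk hkN
    have hN : (0 : ℝ) < N := by exact_mod_cast hk.trans_le hkN
    have h1 : ∀ k : ℕ, 0 < k → k ≤ N → u ((k : ℝ) / N) = k * u (1 / N) := by
      intro k hk hkN
      obtain ⟨k, rfl⟩ := Nat.exists_eq_succ_of_ne_zero hk.ne'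
      rw [← hmul k (1 / N) (by positivity)]
      · rw [mul_one_div]
      · rw [mul_one_div, div_le_one hN]; exact_mod_cast hkN
    have h2 := h1 N (hk.trans_le hkN) le_rfl
    rw [div_self hN.ne'] at h2
    rw [h1 k hk hkN, h2]
    field_simp
  have hu1 : 0 ≤ u 1 := h0 1 one_pos le_rfl
  -- Monotonicity traps `u t` between the values at neighbouring multiples of `1 / N`, where `u` is
  -- known to be linear.
  have hbound : ∀ N : ℕ, 0 < N → |u t - t * u 1| ≤ u 1 / N := by
    intro N hN
    have hN' : (0 : ℝ) < N := by exact_mod_cast hN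
    set k := ⌊t * N⌋₊
    have hk1 : (k : ℝ) / N ≤ t := (div_le_iff₀ hN').2 (Nat.floor_le (by positivity))
    have hk2 : t ≤ ((k + 1 : ℕ) : ℝ) / N := (le_div_iff₀ hN').2 (by
      push_cast; exact (Nat.lt_floor_add_one _).le)
    have hk3 : ((k + 1 : ℕ) : ℝ) / N = (k : ℝ) / N + 1 / N := by push_cast; ring
    have hkt : (k : ℝ) / N * u 1 ≤ t * u 1 := mul_le_mul_of_nonneg_right hk1 hu1
    have htk : t * u 1 ≤ ((k + 1 : ℕ) : ℝ) / N * u 1 := mul_le_mul_of_nonneg_right hk2 hu1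
    have hdiv : u 1 / N = 1 / N * u 1 := by ring
    have hlow : (k : ℝ) / N * u 1 ≤ u t := by
      rcases Nat.eq_zero_or_pos k with h | h
      · rw [h]; simpa using h0 t ht ht1
      · have hkN : k ≤ N := by
          have : (k : ℝ) ≤ N := (div_le_one hN').1 (hk1.trans ht1)
          exact_mod_cast this
        rw [← hrat k N h hkN]
        exact hmono _ _ (by positivity) hk1 ht1
    have hupp : u t ≤ ((k + 1 : ℕ) : ℝ) / N * u 1 := by
      by_cases hkN : k + 1 ≤ N
      · rw [← hrat (k + 1) N k.succ_pos hkN]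
        exact hmono _ _ ht hk2 ((div_le_one hN').2 (by exact_mod_cast hkN))
      · have h1 : (1 : ℝ) ≤ ((k + 1 : ℕ) : ℝ) / N :=
          (one_le_div hN').2 (by exact_mod_cast (not_le.1 hkN).le)
        calc u t ≤ 1 * u 1 := by rw [one_mul]; exact hmono t 1 ht ht1 le_rfl
          _ ≤ _ := mul_le_mul_of_nonneg_right h1 hu1
    rw [hk3, add_mul] at hupp htk
    rw [abs_le, hdiv]
    constructor <;> linarith
  have hlim : Filter.Tendsto (fun N : ℕ => u 1 / (N : ℝ)) Filter.atTop (nhds 0) :=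
    tendsto_const_div_atTop_nhds_zero_nat (u 1)
  have := ge_of_tendsto hlim (Filter.eventually_atTop.2 ⟨1, fun N hN => hbound N hN⟩)
  linarith [abs_nonpos_iff.1 this]

variable {K : (n : ℕ) → Op n → Op n → Op n → ℂ} {n m : ℕ}

lemma coordEmbed_mul_realDiag_mul {k : ℕ} (φ : Fin k → Fin n) (a : Fin k → ℝ) :
    coordEmbed φ * realDiag a * (coordEmbed φ)ᴴ
      = realDiag fun i => ∑ j, if i = φ j then a j else 0 := by
  have h : realDiag a = ∑ j, single j j (a j : ℂ) := (sum_single_eq_diagonal _).symm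
  rw [h, Matrix.mul_sum, Matrix.sum_mul]
  simp only [coordEmbed_mul_single_mul]
  ext p q
  rw [Matrix.sum_apply]
  refine Eq.trans ?_
    (diagonal_apply (fun i => ((∑ j, if i = φ j then a j else 0 : ℝ) : ℂ)) p q).symm
  by_cases hpq : p = q
  · subst hpq
    simp [single_apply, eq_comm, apply_ite Complex.ofReal]
  · rw [if_neg hpq]
    refine Finset.sum_eq_zero fun j _ => ?_
    rw [single_apply_of_ne]
    rintro ⟨rfl, h⟩
    exact hpq h

lemma append_eq_sum (a b : Fin n → ℝ) (i : Fin (n + n)) :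
    Fin.append a b i = (∑ j, if i = Fin.castAdd n j then a j else 0)
      + ∑ j, if i = Fin.natAdd n j then b j else 0 := by
  induction i using Fin.addCases with
  | left i =>
    have : ∀ j, Fin.castAdd n i ≠ Fin.natAdd n j := fun j h => by
      have := congrArg Fin.val h; simp at this; omega
    simp [this, -Fin.natAdd_eq_addNat]
  | right i =>
    have : ∀ j, Fin.natAdd n i ≠ Fin.castAdd n j := fun j h => by
      have := congrArg Fin.val h; simp at this; omega
    simp [this, -Fin.natAdd_eq_addNat]

lemma conjTranspose_coordEmbed_castAdd_mul_natAdd :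
    (coordEmbed (Fin.castAdd n : Fin n → Fin (n + n)))ᴴ
      * coordEmbed (Fin.natAdd n : Fin n → Fin (n + n)) = 0 := by
  ext i j
  have : Fin.castAdd n i ≠ Fin.natAdd n j := fun h => by
    have := congrArg Fin.val h; simp at this; omega
  simp [mul_apply, coordEmbed, conjTranspose_apply, apply_ite star, this.symm,
    -Fin.natAdd_eq_addNat]

/-- The trace-preserving map `X ↦ pX ⊕ rX`, with `p = s/(s+t)` and `r = t/(s+t)`, is undone by
adding the diagonal blocks, so it is isometric; it sends `(s+t) diag a` to `s diag a ⊕ t diag a`.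
The two summands of the image of `eᵢⱼ` are orthogonal, and their lengths are those at `s diag a` and
`t diag a`. -/
lemma IsMonotoneMetric.add_scale (hK : IsMonotoneMetric K) (hn : 0 < n) {a : Fin n → ℝ}
    (ha : ∀ i, 0 < a i) {s t : ℝ} (hs : 0 < s) (ht : 0 < t) (hst : (s + t) * ∑ i, a i ≤ 1)
    (i j : Fin n) :
    (s + t) ^ 2 * (K n (realDiag fun l => (s + t) * a l) (single i j 1) (single i j 1)).re
      = s ^ 2 * (K n (realDiag fun l => s * a l) (single i j 1) (single i j 1)).re
        + t ^ 2 * (K n (realDiag fun l => t * a l) (single i j 1) (single i j 1)).re := by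
  have hst0 : 0 < s + t := add_pos hs ht
  set W₁ := coordEmbed (Fin.castAdd n : Fin n → Fin (n + n)) with hW₁
  set W₂ := coordEmbed (Fin.natAdd n : Fin n → Fin (n + n)) with hW₂
  have h11 : W₁ᴴ * W₁ = 1 := conjTranspose_coordEmbed_mul_self (Fin.castAdd_injective n n)
  have h22 : W₂ᴴ * W₂ = 1 := conjTranspose_coordEmbed_mul_self (Fin.natAdd_injective n n)
  have h12 : W₁ᴴ * W₂ = 0 := conjTranspose_coordEmbed_castAdd_mul_natAdd
  have hnn : 0 < n + n := by omega
  set p := s / (s + t) with hp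
  set r := t / (s + t) with hr
  have hp0 : 0 ≤ p := by positivity
  have hr0 : 0 ≤ r := by positivity
  have hpr : p + r = 1 := by rw [hp, hr]; field_simp
  have hps : p * (s + t) = s := by rw [hp]; field_simp
  have hrt : r * (s + t) = t := by rw [hr]; field_simp
  have hmem : realDiag (fun l => (s + t) * a l) ∈ StrictSubState n := by
    rw [realDiag_mem_strictSubState_iff, ← Finset.mul_sum]
    exact ⟨fun l => mul_pos hst0 (ha l), hst⟩
  set b : Fin (n + n) → ℝ := Fin.append (fun l => s * a l) (fun l => t * a l) with hb
  have hbmem : realDiag b ∈ StrictSubState (n + n) := by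
    rw [realDiag_mem_strictSubState_iff, Fin.sum_univ_add]
    refine ⟨fun i => ?_, ?_⟩
    · induction i using Fin.addCases with
      | left i => rw [hb, Fin.append_left]; exact mul_pos hs (ha i)
      | right i => rw [hb, Fin.append_right]; exact mul_pos ht (ha i)
    · simp only [hb, Fin.append_left, Fin.append_right, ← Finset.mul_sum, ← add_mul]
      exact hst
  have hsqrt : ∀ x : ℝ, 0 ≤ x → (√x : ℂ) * (√x : ℂ) = (x : ℂ) := fun x hx => by
    rw [← Complex.ofReal_mul, Real.mul_self_sqrt hx]
  let A : Bool → Matrix (Fin (n + n)) (Fin n) ℂ := fun c =>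
    cond c ((√p : ℂ) • W₁) ((√r : ℂ) • W₂)
  -- The left inverse: the sum of the two diagonal blocks, a partial trace.
  let C : Bool → Matrix (Fin n) (Fin (n + n)) ℂ := fun c => cond c W₁ᴴ W₂ᴴ
  have hA : ∀ X, krausMap A X = (p : ℂ) • (W₁ * X * W₁ᴴ) + (r : ℂ) • (W₂ * X * W₂ᴴ) := by
    intro X
    simp only [krausMap_apply, Fintype.sum_bool, A, cond_true, cond_false, conjTranspose_smul,
      Matrix.smul_mul, Matrix.mul_smul, smul_smul, Complex.star_def, Complex.conj_ofReal,
      hsqrt _ hp0, hsqrt _ hr0]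
  have hA1 : 1 - ∑ k, (A k)ᴴ * A k = 0 := by
    simp only [Fintype.sum_bool, A, cond_true, cond_false, conjTranspose_smul,
      Matrix.smul_mul, Matrix.mul_smul, smul_smul, Complex.star_def, Complex.conj_ofReal,
      hsqrt _ hp0, hsqrt _ hr0, h11, h22]
    rw [← add_smul, ← Complex.ofReal_add, hpr, Complex.ofReal_one, one_smul, sub_self]
  have hC : ∀ X, krausMap C X = W₁ᴴ * X * W₁ + W₂ᴴ * X * W₂ := by
    intro X
    simp only [krausMap_apply, Fintype.sum_bool, C, cond_true, cond_false,
      conjTranspose_conjTranspose]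
  have hC1 : 1 - ∑ k, (C k)ᴴ * C k = 0 := by
    simp only [Fintype.sum_bool, C, cond_true, cond_false, conjTranspose_conjTranspose]
    have e1 := coordEmbed_mul_realDiag_mul (Fin.castAdd n : Fin n → Fin (n + n)) (fun _ => 1)
    have e2 := coordEmbed_mul_realDiag_mul (Fin.natAdd n : Fin n → Fin (n + n)) (fun _ => 1)
    rw [realDiag_one, Matrix.mul_one] at e1 e2
    rw [hW₁, hW₂, e1, e2, diagonal_add, ← realDiag_one, sub_eq_zero]
    refine congrArg diagonal (funext fun i => ?_)
    rw [← Complex.ofReal_add, ← append_eq_sum]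
    induction i using Fin.addCases <;> simp [-Fin.natAdd_eq_addNat]
  have hCA : ∀ X, krausMap C (krausMap A X) = X := by
    intro X
    have e1 : W₁ᴴ * krausMap A X * W₁ = (p : ℂ) • X := by
      rw [hA, Matrix.mul_add, Matrix.add_mul]
      simp only [Matrix.mul_smul, Matrix.smul_mul]
      have x1 : W₁ᴴ * (W₁ * X * W₁ᴴ) * W₁ = (W₁ᴴ * W₁) * X * (W₁ᴴ * W₁) := by
        simp only [Matrix.mul_assoc]
      have x2 : W₁ᴴ * (W₂ * X * W₂ᴴ) * W₁ = (W₁ᴴ * W₂) * X * (W₂ᴴ * W₁) := by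
        simp only [Matrix.mul_assoc]
      rw [x1, x2, h11, h12]; simp
    have e2 : W₂ᴴ * krausMap A X * W₂ = (r : ℂ) • X := by
      rw [hA, Matrix.mul_add, Matrix.add_mul]
      simp only [Matrix.mul_smul, Matrix.smul_mul]
      have x1 : W₂ᴴ * (W₁ * X * W₁ᴴ) * W₂ = (W₂ᴴ * W₁) * X * (W₁ᴴ * W₂) := by
        simp only [Matrix.mul_assoc]
      have x2 : W₂ᴴ * (W₂ * X * W₂ᴴ) * W₂ = (W₂ᴴ * W₂) * X * (W₂ᴴ * W₂) := by
        simp only [Matrix.mul_assoc]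
      rw [x1, x2, h22, h12]; simp
    rw [hC, e1, e2, ← add_smul, ← Complex.ofReal_add, hpr, Complex.ofReal_one, one_smul]
  have hAρ : krausMap A (realDiag fun l => (s + t) * a l) = realDiag b := by
    rw [hA, coordEmbed_mul_realDiag_mul (Fin.castAdd n),
      coordEmbed_mul_realDiag_mul (Fin.natAdd n), ← diagonal_smul, ← diagonal_smul,
      diagonal_add]
    refine congrArg diagonal (funext fun i => ?_)
    rw [hb, append_eq_sum, Pi.smul_apply, Pi.smul_apply, smul_eq_mul, smul_eq_mul,
      ← Complex.ofReal_mul, ← Complex.ofReal_mul, ← Complex.ofReal_add, Finset.mul_sum,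
      Finset.mul_sum]
    simp only [mul_ite, mul_zero, ← mul_assoc, hps, hrt]
  let E : Op n := single i j 1
  have hE : single i j 1 = E := rfl
  rw [hE]
  have hzero : ∀ {k : ℕ} (X : Op k), (X - X).PosSemidef := fun X => by
    rw [sub_self]; exact .zero
  have hiso : (K (n + n) (realDiag b) (krausMap A (E)) (krausMap A (E))).re
      = (K n (realDiag fun l => (s + t) * a l) (E) (E)).re := by
    refine le_antisymm ?_ ?_
    · exact hK.krausMap_le hn hnn (by rw [hA1]; exact .zero) hmem hbmem
        (by rw [hAρ]; exact hzero _) _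
    · have := hK.krausMap_le hnn hn (by rw [hC1]; exact .zero) hbmem hmem
        (by rw [← hAρ, hCA]; exact hzero _) (krausMap A (E))
      rwa [hCA] at this
  have hB := hK.isInnerForm hnn hbmem
  have e1 : (K (n + n) (realDiag b) (W₁ * E * W₁ᴴ) (W₁ * E * W₁ᴴ)).re
      = (K n (realDiag fun l => s * a l) (E) (E)).re := by
    rw [hK.coordEmbed_conj hnn hn (Fin.castAdd_injective n n) hbmem]
    congr 3
    funext l
    rw [Function.comp_apply, hb, Fin.append_left]
  have e2 : (K (n + n) (realDiag b) (W₂ * E * W₂ᴴ) (W₂ * E * W₂ᴴ)).re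
      = (K n (realDiag fun l => t * a l) (E) (E)).re := by
    rw [hK.coordEmbed_conj hnn hn (Fin.natAdd_injective n n) hbmem]
    congr 3
    funext l
    rw [Function.comp_apply, hb, Fin.append_right]
  have horth : K (n + n) (realDiag b) (W₁ * E * W₁ᴴ) (W₂ * E * W₂ᴴ) = 0 := by
    rw [hW₁, hW₂, ← hE, coordEmbed_mul_single_mul, coordEmbed_mul_single_mul]
    refine hK.single_orthogonal hnn hbmem (fun h => ?_) _ _
    have := congrArg Fin.val (congrArg Prod.fst h)
    simp at this
    omega
  rw [← hiso, hA, hB.re_add, hB.re_smul, hB.re_smul, hB.smul_left, hB.smul_right, horth, e1, e2,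
    Complex.normSq_ofReal, Complex.normSq_ofReal]
  simp only [mul_zero, Complex.zero_re, add_zero]
  generalize (K n (realDiag fun l => s * a l) (E) (E)).re = x
  generalize (K n (realDiag fun l => t * a l) (E) (E)).re = y
  calc (s + t) ^ 2 * (p * p * x + r * r * y)
      = (p * (s + t)) ^ 2 * x + (r * (s + t)) ^ 2 * y := by ring
    _ = _ := by rw [hps, hrt]

/-- Homogeneity of degree `-1` in the base point. -/
lemma IsMonotoneMetric.scale (hK : IsMonotoneMetric K) (hn : 0 < n) {a : Fin n → ℝ}
    (ha : realDiag a ∈ StrictSubState n) {t : ℝ} (ht : 0 < t) (ht1 : t ≤ 1) (i j : Fin n) :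
    t * (K n (realDiag fun l => t * a l) (single i j 1) (single i j 1)).re
      = (K n (realDiag a) (single i j 1) (single i j 1)).re := by
  obtain ⟨ha0, has⟩ := realDiag_mem_strictSubState_iff.1 ha
  have hs0 : 0 ≤ ∑ i, a i := Finset.sum_nonneg fun i _ => (ha0 i).le
  have h := eq_mul_of_additive_of_nonneg (u := fun t => t ^ 2 *
    (K n (realDiag fun l => t * a l) (single i j 1) (single i j 1)).re) ?_ ?_ ht ht1
  · simp only [one_pow, one_mul] at h
    refine mul_left_cancel₀ ht.ne' ?_
    rw [← h]; ring
  · intro t ht ht1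
    have hmem : realDiag (fun l => t * a l) ∈ StrictSubState n := by
      rw [realDiag_mem_strictSubState_iff, ← Finset.mul_sum]
      exact ⟨fun l => mul_pos ht (ha0 l), mul_le_one₀ ht1 hs0 has⟩
    exact mul_nonneg (sq_nonneg t) ((hK.isInnerForm hn hmem).re_nonneg _)
  · intro s t hs ht hst
    exact hK.add_scale hn ha0 hs ht (mul_le_one₀ hst hs0 has) i j

end Scaling

/-! ### The function of a metric, its Petz form and its operator monotonicity. -/

section Representation

variable {K : (n : ℕ) → Op n → Op n → Op n → ℂ} {n : ℕ}

/-- The squared length of the off-diagonal matrix unit at the state `diag(x, y)`. -/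
noncomputable def unitLength (K : (n : ℕ) → Op n → Op n → Op n → ℂ) (x y : ℝ) : ℝ :=
  (K 2 (realDiag ![x, y]) (single 0 1 1) (single 0 1 1)).re

/-- The operator monotone function of a monotone metric. -/
noncomputable def metricFun (K : (n : ℕ) → Op n → Op n → Op n → ℂ) (x : ℝ) : ℝ :=
  ((1 + x)⁻¹ * unitLength K (x * (1 + x)⁻¹) (1 + x)⁻¹)⁻¹

lemma pair_mem_strictSubState {x y : ℝ} (hx : 0 < x) (hy : 0 < y) (hxy : x + y ≤ 1) :
    realDiag ![x, y] ∈ StrictSubState 2 := by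
  rw [realDiag_mem_strictSubState_iff, Fin.sum_univ_two]
  exact ⟨fun i => by fin_cases i <;> assumption, hxy⟩

lemma single_ne_zero (i j : Fin n) : (single i j 1 : Op n) ≠ 0 := fun h => by
  have := congrFun (congrFun h i) j
  simp at this

lemma IsMonotoneMetric.unitLength_pos (hK : IsMonotoneMetric K) {x y : ℝ} (hx : 0 < x) (hy : 0 < y)
    (hxy : x + y ≤ 1) : 0 < unitLength K x y :=
  (hK.isInnerForm two_pos (pair_mem_strictSubState hx hy hxy)).re_pos (single_ne_zero 0 1)

lemma normalized_pair {x : ℝ} (hx : 0 < x) :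
    0 < x * (1 + x)⁻¹ ∧ 0 < (1 + x)⁻¹ ∧ x * (1 + x)⁻¹ + (1 + x)⁻¹ = 1 := by
  have h : 0 < 1 + x := by linarith
  refine ⟨by positivity, by positivity, ?_⟩
  field_simp
  ring

lemma IsMonotoneMetric.metricFun_pos (hK : IsMonotoneMetric K) {x : ℝ} (hx : 0 < x) :
    0 < metricFun K x := by
  obtain ⟨h1, h2, h3⟩ := normalized_pair hx
  exact inv_pos.2 (mul_pos h2 (hK.unitLength_pos h1 h2 h3.le))

/-- `metricFun` reads lengths at trace one; homogeneity with factor `x + y` carries them to every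
admissible pair with the same ratio. -/
lemma IsMonotoneMetric.unitLength_eq (hK : IsMonotoneMetric K) {x y : ℝ} (hx : 0 < x) (hy : 0 < y)
    (hxy : x + y ≤ 1) : unitLength K x y = (y * metricFun K (x / y))⁻¹ := by
  obtain ⟨h1, h2, h3⟩ := normalized_pair (div_pos hx hy)
  have hs : 0 < x + y := add_pos hx hy
  have h := hK.scale two_pos (pair_mem_strictSubState h1 h2 h3.le) hs hxy 0 1
  have e1 : (x + y) * (1 + x / y)⁻¹ = y := by field_simp; ring
  have e2 : (x + y) * (x / y * (1 + x / y)⁻¹) = x := by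
    rw [mul_left_comm, e1]; field_simp
  have e3 : (fun l : Fin 2 => (x + y) * ![x / y * (1 + x / y)⁻¹, (1 + x / y)⁻¹] l) = ![x, y] := by
    funext l; fin_cases l
    · exact e2
    · exact e1
  rw [e3] at h
  rw [metricFun, unitLength, unitLength, ← h, mul_inv, inv_inv, ← mul_assoc, ← mul_assoc,
    mul_assoc y⁻¹, mul_comm (1 + x / y)⁻¹, e1, inv_mul_cancel₀ hy.ne', one_mul]

lemma IsMonotoneMetric.re_single_of_ne (hK : IsMonotoneMetric K) (hn : 0 < n) {a : Fin n → ℝ}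
    (ha : realDiag a ∈ StrictSubState n) {i j : Fin n} (hij : i ≠ j) :
    (K n (realDiag a) (single i j 1) (single i j 1)).re = (a j * metricFun K (a i / a j))⁻¹ := by
  obtain ⟨ha0, has⟩ := realDiag_mem_strictSubState_iff.1 ha
  have hφ : Function.Injective ![i, j] := by
    intro p q
    fin_cases p <;> fin_cases q <;> simp [hij, hij.symm]
  have h1 := hK.coordEmbed_conj hn two_pos hφ ha (single 0 1 1)
  have h2 : a ∘ ![i, j] = ![a i, a j] := by funext l; fin_cases l <;> rfl
  have hmem := realDiag_comp_mem_strictSubState hφ ha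
  rw [h2, realDiag_mem_strictSubState_iff, Fin.sum_univ_two] at hmem
  rw [coordEmbed_mul_single_mul, h2] at h1
  rw [← hK.unitLength_eq (ha0 i) (ha0 j) hmem.2]
  exact h1

lemma half_mem_strictSubState : realDiag (fun _ : Fin 2 => (1 / 2 : ℝ)) ∈ StrictSubState 2 := by
  rw [realDiag_mem_strictSubState_iff, Fin.sum_univ_two]
  norm_num

/-- Unitary invariance at the maximally mixed state of a qubit. -/
lemma IsMonotoneMetric.re_single_half (hK : IsMonotoneMetric K) :
    (K 2 (realDiag fun _ => 1 / 2) (single 0 0 1) (single 0 0 1)).re = 2 / metricFun K 1 := by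
  have hinv : ∀ (U : Op 2), Uᴴ * U = 1 → ∀ X, (K 2 (realDiag fun _ => 1 / 2) (U * X * Uᴴ)
      (U * X * Uᴴ)).re = (K 2 (realDiag fun _ => 1 / 2) X X).re := by
    intro U hU X
    have h := hK.unitary_conj two_pos hU half_mem_strictSubState X
    have h1 : U * realDiag (fun _ => 1 / 2) * Uᴴ = realDiag fun _ => 1 / 2 := by
      have : (realDiag fun _ : Fin 2 => 1 / 2) = ((1 / 2 : ℝ) : ℂ) • (1 : Op 2) :=
        (smul_one_eq_diagonal _).symm
      rw [this, mul_smul_comm, smul_mul_assoc, mul_one, mul_eq_one_comm.1 hU]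
    rwa [h1] at h
  have hsq : (√2 : ℂ) * √2 = 2 := by
    rw [← Complex.ofReal_mul, Real.mul_self_sqrt zero_le_two]; norm_num
  -- The Hadamard matrix spreads `e₀₀` evenly over all four units. As `e₀₀` and `e₁₁` have equal
  -- length `d` by the swap, and the off-diagonal units have length `2 / f 1`, invariance reads `d =
  -- (2d + 4 / f 1) / 4`.
  let H : Op 2 := ((√2 : ℝ) : ℂ)⁻¹ • !![1, 1; 1, -1]
  have hinv2 : (√2 : ℂ)⁻¹ * (√2 : ℂ)⁻¹ = 1 / 2 := by rw [← mul_inv, hsq, one_div]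
  have hH : Hᴴ = H := by
    ext i j; fin_cases i <;> fin_cases j <;> simp [H, conjTranspose_apply]
  have hHH : Hᴴ * H = 1 := by
    rw [hH]
    simp only [H, Matrix.smul_mul, Matrix.mul_smul, smul_smul, hinv2]
    ext i j; fin_cases i <;> fin_cases j <;> norm_num [mul_apply, Fin.sum_univ_two]
  have hsum := hK.re_eq_sum two_pos half_mem_strictSubState (H * single 0 0 1 * Hᴴ)
  rw [hinv H hHH] at hsum
  have hent : ∀ i j, Complex.normSq ((H * (single 0 0 1 : Op 2) * Hᴴ) i j) = 1 / 4 := by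
    intro i j
    rw [hH]
    simp only [H, Matrix.smul_mul, Matrix.mul_smul, Matrix.smul_apply,
      smul_eq_mul, Complex.normSq_mul]
    fin_cases i <;> fin_cases j <;>
      norm_num [vecMul, dotProduct, Fin.sum_univ_two, Complex.normSq_apply, single_apply]
  simp only [hent, Fin.sum_univ_two] at hsum
  have h11 := hinv !![0, 1; 1, 0] (by
    ext i j; fin_cases i <;> fin_cases j <;>
      simp [mul_apply, Fin.sum_univ_two, conjTranspose_apply]) (single 0 0 1)
  have hswap : (!![0, 1; 1, 0] : Op 2) * single 0 0 1 * (!![0, 1; 1, 0] : Op 2)ᴴ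
      = single 1 1 1 := by
    ext i j; fin_cases i <;> fin_cases j <;>
      simp [vecMul, dotProduct, Fin.sum_univ_two]
  rw [hswap] at h11
  have h01 := hK.re_single_of_ne two_pos half_mem_strictSubState (i := 0) (j := 1) (by simp)
  have h10 := hK.re_single_of_ne two_pos half_mem_strictSubState (i := 1) (j := 0) (by simp)
  rw [h11, h01, h10] at hsum
  norm_num at hsum
  rw [div_eq_mul_inv (2 : ℝ)]
  linarith

/-- Restriction to one coordinate and homogeneity show that `a i` times the length is a universal
constant, the length at the state `1` in dimension one. The qubit state `1/2` evaluates it. -/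
lemma IsMonotoneMetric.re_single_self (hK : IsMonotoneMetric K) (hn : 0 < n) {a : Fin n → ℝ}
    (ha : realDiag a ∈ StrictSubState n) (i : Fin n) :
    (K n (realDiag a) (single i i 1) (single i i 1)).re = (a i * metricFun K 1)⁻¹ := by
  have key : ∀ {n : ℕ} (_ : 0 < n) {a : Fin n → ℝ} (_ : realDiag a ∈ StrictSubState n) (i : Fin n),
      a i * (K n (realDiag a) (single i i 1) (single i i 1)).re
        = (K 1 (realDiag fun _ => 1) (single 0 0 1) (single 0 0 1)).re := by
    intro n hn a ha i
    obtain ⟨ha0, has⟩ := realDiag_mem_strictSubState_iff.1 ha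
    have hφ : Function.Injective (fun _ : Fin 1 => i) := fun p q _ => Subsingleton.elim p q
    have h1 := hK.coordEmbed_conj hn one_pos hφ ha (single 0 0 1)
    rw [coordEmbed_mul_single_mul] at h1
    have h1mem : realDiag (fun _ : Fin 1 => 1) ∈ StrictSubState 1 := by
      rw [realDiag_mem_strictSubState_iff]; simp
    have hai : a i ≤ 1 :=
      (Finset.single_le_sum (fun j _ => (ha0 j).le) (Finset.mem_univ i)).trans has
    have h2 := hK.scale one_pos h1mem (ha0 i) hai 0 0
    simp only [mul_one] at h2
    rw [h1, ← h2]
    rfl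
  have h1 := key hn ha i
  have h2 := key two_pos half_mem_strictSubState 0
  rw [hK.re_single_half] at h2
  have hai := (realDiag_mem_strictSubState_iff.1 ha).1 i
  have hf := hK.metricFun_pos one_pos
  rw [← h2] at h1
  refine eq_inv_of_mul_eq_one_left ?_
  field_simp at h1
  linarith

/-- A monotone metric is the Petz form of its function. -/
lemma IsMonotoneMetric.eq_petzForm (hK : IsMonotoneMetric K) (hn : 0 < n) {ρ : Op n}
    (hρ : ρ ∈ StrictSubState n) (X Y : Op n) : K n ρ X Y = petzForm (metricFun K) ρ X Y := by
  have hf0 : ∀ x, 0 < x → 0 < metricFun K x := fun x hx => hK.metricFun_pos hx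
  have hdiag : ∀ {a : Fin n → ℝ} (_ : realDiag a ∈ StrictSubState n) (X : Op n),
      (K n (realDiag a) X X).re = (petzForm (metricFun K) (realDiag a) X X).re := by
    intro a ha X
    have ha0 := (realDiag_mem_strictSubState_iff.1 ha).1
    rw [hK.re_eq_sum hn ha, petzForm_realDiag_self hf0 ha0, Complex.ofReal_re]
    refine Finset.sum_congr rfl fun i _ => Finset.sum_congr rfl fun j _ => ?_
    by_cases hij : i = j
    · subst hij
      rw [hK.re_single_self hn ha, div_self (ha0 i).ne']
    · rw [hK.re_single_of_ne hn ha hij]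
  refine (hK.isInnerForm hn hρ).ext_re (exists_core_petzForm hf0 hρ.1) (fun X => ?_) X Y
  obtain ⟨U, a, hU, ha, rfl⟩ := PosDef.exists_eq_conj_realDiag hρ.1
  have hU' : Uᴴᴴ * Uᴴ = 1 := by rw [conjTranspose_conjTranspose]; exact mul_eq_one_comm.1 hU
  have hmem : realDiag a ∈ StrictSubState n := by
    have := conj_mem_strictSubState hU' hρ
    rwa [conjTranspose_conjTranspose, conj_mul_conj_cancel hU] at this
  have h := hK.unitary_conj hn hU' hρ X
  rw [conjTranspose_conjTranspose, conj_mul_conj_cancel hU] at h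
  rw [petzForm_conj hf0 hU ha, ← h, hdiag hmem]

/-- The quadratic form of `f(A)⁻¹` as a Petz form at `diag(A, 1)`, up to the scale `ε`. -/
lemma petzForm_fromBlocks {f : ℝ → ℝ} (hf0 : ∀ x, 0 < x → 0 < f x) {U : Op n} (hU : Uᴴ * U = 1)
    {a : Fin n → ℝ} (ha : ∀ i, 0 < a i) {ε : ℝ} (hε : 0 < ε) (v : Fin n → ℂ) :
    (petzForm f (((ε : ℂ) • fromBlocks (U * realDiag a * Uᴴ) 0 0 1).submatrix
        (finSumFinEquiv (m := n) (n := 1)).symm (finSumFinEquiv (m := n) (n := 1)).symm)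
      ((fromBlocks 0 (of fun i _ => v i) 0 0).submatrix
        (finSumFinEquiv (m := n) (n := 1)).symm (finSumFinEquiv (m := n) (n := 1)).symm)
      ((fromBlocks 0 (of fun i _ => v i) 0 0).submatrix
        (finSumFinEquiv (m := n) (n := 1)).symm (finSumFinEquiv (m := n) (n := 1)).symm)).re
      = ε⁻¹ * (star v ⬝ᵥ ((U * realDiag (fun i => (f (a i))⁻¹) * Uᴴ) *ᵥ v)).re := by
  set e := (finSumFinEquiv (m := n) (n := 1)).symm
  set Uh : Op (n + 1) := (fromBlocks U 0 0 1).submatrix e e with hUh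
  set b : Fin (n + 1) → ℝ := fun i => ε * Sum.elim a (fun _ => 1) (e i) with hb
  have hb0 : ∀ i, 0 < b i := fun i => mul_pos hε (by rcases e i with j | j <;> simp [ha])
  have hUhH : Uhᴴ = (fromBlocks Uᴴ 0 0 1).submatrix e e := by
    rw [hUh, conjTranspose_submatrix, fromBlocks_conjTranspose]; simp
  have hUU : Uhᴴ * Uh = 1 := by
    rw [hUhH, hUh, submatrix_mul_equiv, fromBlocks_multiply]
    simp [hU]
  have hρ : ((ε : ℂ) • fromBlocks (U * realDiag a * Uᴴ) 0 0 1).submatrix e e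
      = Uh * realDiag b * Uhᴴ := by
    have hd : realDiag b = ((ε : ℂ) • fromBlocks (realDiag a) 0 0 1).submatrix e e := by
      have : ((ε : ℂ) • fromBlocks (realDiag a) 0 0 (1 : Matrix (Fin 1) (Fin 1) ℂ))
          = realDiag fun i => ε * Sum.elim a (fun _ => 1) i := by
        rw [← realDiag_one, fromBlocks_diagonal, ← diagonal_smul]
        refine congrArg diagonal (funext fun i => ?_)
        cases i <;> simp
      rw [this, submatrix_diagonal_equiv]
      rfl
    rw [hUhH, hUh, hd, submatrix_mul_equiv, submatrix_mul_equiv, Matrix.mul_smul, Matrix.smul_mul,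
      fromBlocks_multiply, fromBlocks_multiply]
    simp
  have hX : Uhᴴ * (fromBlocks 0 (of fun i _ => v i) 0 0).submatrix e e * Uh
      = (fromBlocks 0 (of fun i _ => (Uᴴ *ᵥ v) i) 0 0).submatrix e e := by
    rw [hUhH, hUh, submatrix_mul_equiv, submatrix_mul_equiv, fromBlocks_multiply,
      fromBlocks_multiply]
    congr 1
    simp only [Matrix.zero_mul, Matrix.mul_zero, add_zero, zero_add, Matrix.mul_one]
    congr 1
  rw [hρ, petzForm_conj hf0 hUU hb0, hX, petzForm_realDiag_self hf0 hb0, Complex.ofReal_re,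
    ← mulVec_mulVec, ← mulVec_mulVec, dotProduct_mulVec]
  have hst : star v ᵥ* U = star (Uᴴ *ᵥ v) := by rw [star_mulVec, conjTranspose_conjTranspose]
  rw [hst, dotProduct_realDiag_mulVec, Complex.ofReal_re, Finset.mul_sum]
  have hsum : ∀ g : Fin (n + 1) → Fin (n + 1) → ℝ,
      ∑ i, ∑ j, g i j = ∑ p, ∑ q, g (e.symm p) (e.symm q) := fun g => by
    rw [← e.symm.sum_comp]
    exact Finset.sum_congr rfl fun p _ => (e.symm.sum_comp _).symm
  rw [hsum]
  simp only [submatrix_apply, Equiv.apply_symm_apply, hb, Fintype.sum_sum_type,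
    fromBlocks_apply₁₁, fromBlocks_apply₁₂, fromBlocks_apply₂₁, fromBlocks_apply₂₂,
    Sum.elim_inl, Sum.elim_inr, Matrix.zero_apply, map_zero, zero_mul, Finset.sum_const_zero,
    add_zero, zero_add, of_apply, Finset.univ_unique, Finset.sum_singleton, mul_one]
  -- Only the last column survives; there the weight is `ε f(ε a i / ε) = ε f(a i)`.
  refine Finset.sum_congr rfl fun i _ => ?_
  rw [mul_div_cancel_left₀ _ hε.ne', mul_inv]
  ring

/-- Hypothesis and conclusion are the two Schur complement criteria for positivity of the block
matrix with rows `(Q, 1)` and `(1, P⁻¹)`. -/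
lemma posSemidef_sub_of_inv_sub {P Q : Matrix (Fin n) (Fin n) ℂ} (hP : P.PosDef) (hQ : Q.PosDef)
    (h : (P⁻¹ - Q⁻¹).PosSemidef) : (Q - P).PosSemidef := by
  have := hQ.isUnit.invertible
  have := hP.inv.isUnit.invertible
  have h1 := (PosDef.fromBlocks₁₁ (1 : Matrix (Fin n) (Fin n) ℂ) P⁻¹ hQ).2 (by simpa using h)
  have h2 := (PosDef.fromBlocks₂₂ Q (1 : Matrix (Fin n) (Fin n) ℂ) hP.inv).1 h1
  rwa [Matrix.one_mul, conjTranspose_one, Matrix.mul_one,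
    nonsing_inv_nonsing_inv _ ((isUnit_iff_isUnit_det _).1 hP.isUnit)] at h2

lemma IsMonotoneMetric.operatorMonotone (hK : IsMonotoneMetric K) :
    OperatorMonotone (metricFun K) := by
  intro n A B hA hB hAB
  have hf0 : ∀ x, 0 < x → 0 < metricFun K x := fun x hx => hK.metricFun_pos hx
  obtain ⟨U, a, hU, ha, hAU⟩ := PosDef.exists_eq_conj_realDiag hA
  obtain ⟨W, b, hW, hb, hBW⟩ := PosDef.exists_eq_conj_realDiag hB
  set e := (finSumFinEquiv (m := n) (n := 1)).symm
  let F : ℝ → Op n → Op (n + 1) := fun ε A => ((ε : ℂ) • fromBlocks A 0 0 1).submatrix e e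
  have htr : ∀ ε A, (F ε A).trace.re = ε * (A.trace.re + 1) := by
    intro ε A
    have : (F ε A).trace = (ε : ℂ) * (A.trace + 1) := by
      refine (Fintype.sum_equiv e _ (fun i => ((ε : ℂ) • fromBlocks A 0 0 1) i i)
        fun i => rfl).trans ?_
      rw [Fintype.sum_sum_type, mul_add, trace, Finset.mul_sum]
      simp
    rw [this, Complex.re_ofReal_mul]
    simp
  have hpd : ∀ ε A, 0 < ε → A.PosDef → (F ε A).PosDef := by
    intro ε A hε hA
    refine (PosDef.smul ?_ (by exact_mod_cast hε)).submatrix e.injective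
    let : Invertible (1 : Matrix (Fin 1) (Fin 1) ℂ) := invertibleOne
    have h := (PosDef.fromBlocks₂₂ A (0 : Matrix (Fin n) (Fin 1) ℂ) PosDef.one).2
      (by simpa using hA.posSemidef)
    rw [conjTranspose_zero] at h
    refine h.posDef_iff_isUnit.2 ?_
    rw [isUnit_iff_isUnit_det, det_fromBlocks_zero₂₁, det_one, mul_one]
    exact (isUnit_iff_isUnit_det _).1 hA.isUnit
  have htA : 0 ≤ A.trace.re := (Complex.le_def.1 hA.posSemidef.trace_nonneg).1
  have htB : 0 ≤ B.trace.re := (Complex.le_def.1 hB.posSemidef.trace_nonneg).1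
  have htAB : 0 ≤ (B - A).trace.re := (Complex.le_def.1 hAB.trace_nonneg).1
  rw [trace_sub, Complex.sub_re] at htAB
  -- This makes `ε diag(B, 1)` have trace one; the state of `A` then has trace at most one, since `A
  -- ≤ B`.
  set ε := (B.trace.re + 1)⁻¹ with hε
  have hε0 : 0 < ε := by positivity
  have hFB : F ε B ∈ StrictSubState (n + 1) :=
    ⟨hpd ε B hε0 hB, by rw [htr, hε, inv_mul_cancel₀ (by positivity)]⟩
  have hFA : F ε A ∈ StrictSubState (n + 1) := by
    refine ⟨hpd ε A hε0 hA, le_trans ?_ hFB.2⟩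
    rw [htr, htr]
    exact mul_le_mul_of_nonneg_left (by linarith) hε0.le
  have hdiff : (F ε B - F ε A).PosSemidef := by
    have h := ((hAB.mul_mul_conjTranspose_same
      (fromRows 1 (0 : Matrix (Fin 1) (Fin n) ℂ))).smul hε0.le).submatrix e
    convert h using 1
    ext i j
    simp only [F, conjTranspose_fromRows_eq_fromCols_conjTranspose, fromRows_mul, mul_fromCols,
      Matrix.sub_apply, submatrix_apply, Matrix.smul_apply]
    rcases e i with i | i <;> rcases e j with j | j <;> simp [mul_sub]
  have hquad : ∀ v : Fin n → ℂ,
      (star v ⬝ᵥ ((W * realDiag (fun i => (metricFun K (b i))⁻¹) * Wᴴ) *ᵥ v)).re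
        ≤ (star v ⬝ᵥ ((U * realDiag (fun i => (metricFun K (a i))⁻¹) * Uᴴ) *ᵥ v)).re := by
    intro v
    -- Monotonicity under the identity map, where only `σ` acts: enlarging the base point shortens
    -- vectors.
    have h := hK.conj_le n.succ_pos n.succ_pos (A := 1) (by simpa using PosSemidef.zero) hFA hFB
      (by simpa using hdiff) ((fromBlocks 0 (of fun i _ => v i) 0 0).submatrix e e)
    rw [conjTranspose_one, one_mul, mul_one, hK.eq_petzForm n.succ_pos hFB,
      hK.eq_petzForm n.succ_pos hFA] at h
    simp only [F, hAU, hBW] at h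
    rw [petzForm_fromBlocks hf0 hU ha hε0, petzForm_fromBlocks hf0 hW hb hε0] at h
    exact le_of_mul_le_mul_left h (inv_pos.2 hε0)
  rw [hAU, hBW, cfc_conj_realDiag _ hU, cfc_conj_realDiag _ hW]
  have hpos : ∀ {U : Op n} {a : Fin n → ℝ}, Uᴴ * U = 1 → (∀ i, 0 < a i) →
      (U * (realDiag fun i => metricFun K (a i)) * Uᴴ).PosDef := by
    intro U a hU ha
    rw [posDef_conj_iff hU, posDef_diagonal_iff]
    exact fun i => by exact_mod_cast hf0 _ (ha i)
  refine posSemidef_sub_of_inv_sub (hpos hU ha) (hpos hW hb) ?_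
  have hherm := (hpos hU ha).inv.1.sub (hpos hW hb).inv.1
  refine .of_dotProduct_mulVec_nonneg hherm fun v => ?_
  refine Complex.le_def.2 ⟨?_, (hherm.im_star_dotProduct_mulVec_self v).symm⟩
  rw [conj_realDiag_inv hU fun i => hf0 _ (ha i), conj_realDiag_inv hW fun i => hf0 _ (hb i),
    sub_mulVec, dotProduct_sub, Complex.sub_re]
  exact sub_nonneg.2 (hquad v)

end Representation

end CPTNI

theorem mainTheorem1 (K : (n : ℕ) → CPTNI.Op n → CPTNI.Op n → CPTNI.Op n → ℂ) :
    CPTNI.IsMonotoneMetric K ↔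
      ∃ f : ℝ → ℝ, (∀ x : ℝ, 0 < x → 0 < f x) ∧ CPTNI.OperatorMonotone f ∧
        ∀ n : ℕ, 0 < n → ∀ ρ ∈ CPTNI.StrictSubState n, ∀ X Y : CPTNI.Op n,
          K n ρ X Y = CPTNI.petzForm f ρ X Y := by
  constructor
  · intro hK
    exact ⟨CPTNI.metricFun K, fun x hx => hK.metricFun_pos hx, hK.operatorMonotone,
      fun n hn ρ hρ X Y => hK.eq_petzForm hn hρ X Y⟩
  · rintro ⟨f, hf0, hf, h⟩
    refine ⟨fun n hn ρ hρ => ?_, fun n m hn hm T hT X ρ hρ σ hσ hρσ => ?_⟩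
    · obtain ⟨c, hc⟩ := CPTNI.exists_core_petzForm hf0 hρ.1
      exact ⟨c, fun X Y => (hc X Y).trans (h n hn ρ hρ X Y).symm⟩
    · rw [h m hm _ hρσ, h n hn ρ hρ]
      exact CPTNI.petzForm_add_le hf0 hf hT hρ.1 hσ.1 hρσ.1 X
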